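/- Let $q \ge 3$ be an integer, $\lambda = 2\cos(\pi/q)$ and $\alpha \in [1/2, 1/\lambda]$. Let $G_q \le \mathrm{SL}_2(\mathbb R)$ be the Hecke group generated by $\begin{pmatrix}1&\lambda\\0&1\end{pmatrix}$ and $\begin{pmatrix}0&-1\\1&0\end{pmatrix}$; a real number is called $G_q$-irrational if it is not of the form $a/c$ with $\begin{pmatrix}a&b\\c&d\end{pmatrix}\in G_q$, $c\neq 0$. The $\alpha$-Rosen map $T_\alpha$ on $I_\alpha=[(\alpha-1)\lambda,\alpha\lambda)$ is given by $T_\alpha(0)=0$ and $T_\alpha(t)=\varepsilon(t)/t-\lambda\, d(t)$ for $t\ne 0$, where $\varepsilon(t)=\operatorname{sgn}(t)$ and $d(t)=\left\lfloor \left|\frac1{\lambda t}\right|+1-\alpha\right\rfloor$. For real $x$ let $d_0=\lfloor x/\lambda+1-\alpha\rfloor$, so that $x-d_0\lambda\in I_\alpha$ (and $d_0=0$ if $x\in I_\alpha$). For $n\ge1$ put $\varepsilon_n=\varepsilon(T_\alpha^{n-1}(x-d_0\lambda))$ and $d_n=d(T_\alpha^{n-1}(x-d_0\lambda))$, as long as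 $T_\alpha^{n-1}(x-d_0\lambda)\neq0$ (which holds for all $n$ if $x$ is $G_q$-irrational). The $\alpha$-Rosen convergents of $x$ are $$\frac{p_n}{q_n}=d_0\lambda+\cfrac{\varepsilon_1}{d_1\lambda+\cfrac{\varepsilon_2}{d_2\lambda+\cdots+\cfrac{\varepsilon_n}{d_n\lambda}}},\qquad n\ge 0,$$ with $p_{-1}=1,\ q_{-1}=0,\ p_0=d_0\lambda,\ q_0=1$, $p_n=d_n\lambda p_{n-1}+\varepsilon_n p_{n-2}$ and $q_n=d_n\lambda q_{n-1}+\varepsilon_n q_{n-2}$ for $n\ge1$. Put $$\mathcal H_q=\begin{cases}\dfrac12 & q\text{ even},\\[2mm] \dfrac1{\sqrt{\lambda^2-4\lambda+8}} & q\text{ odd.}\end{cases}$$ Then for every $G_q$-irrational $x\in\mathbb R$ there are infinitely many $n\in\mathbb N$ with $$q_n^2\left|x-\frac{p_n}{q_n}\right|\le\mathcal H_q.$$ The constant $\mathcal H_q$ is best possible: for every real $c<\mathcal H_q$ there is a $G_q$-irrational $x\in I_\alpha$ for which $q_n^2|x-p_n/q_n|\le c$ holds for only finitely many $n$. -/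

import Mathlib

namespace AlphaRosen

noncomputable section

/-- The translation length `λ = 2 cos (π / q)`. -/
def lam (q : ℕ) : ℝ := 2 * Real.cos (Real.pi / q)

/-- The Hecke group `G_q ≤ SL(2, ℝ)`, generated by `z ↦ z + λ` and `z ↦ -1 / z`. -/
def heckeGroup (q : ℕ) : Subgroup (Matrix.SpecialLinearGroup (Fin 2) ℝ) :=
  Subgroup.closure
    {⟨!![1, lam q; 0, 1], by simp [Matrix.det_fin_two]⟩,
     ⟨!![0, -1; 1, 0], by simp [Matrix.det_fin_two]⟩}

/-- A real number is `G_q`-rational if it lies in the orbit `G_q(∞)`, i.e. if it equals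
`g(∞) = a / c` for some `g = (a b; c d)` in `G_q` with `c ≠ 0`. -/
def IsHeckeRational (q : ℕ) (x : ℝ) : Prop :=
  ∃ g ∈ heckeGroup q, g.1 1 0 ≠ 0 ∧ x = g.1 0 0 / g.1 1 0

/-- A real number is `G_q`-irrational if it is not `G_q`-rational. -/
def IsHeckeIrrational (q : ℕ) (x : ℝ) : Prop := ¬ IsHeckeRational q x

/-- The digit `d(t) = ⌊|1 / (λ t)| + 1 - α⌋`. -/
def digit (q : ℕ) (α t : ℝ) : ℤ := ⌊|1 / (lam q * t)| + 1 - α⌋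

/-- The `α`-Rosen operator `T_α(t) = ε(t) / t - λ d(t)` for `t ≠ 0`, and `T_α(0) = 0`,
where `ε(t)` is the sign of `t`. -/
def rosenMap (q : ℕ) (α t : ℝ) : ℝ :=
  if t = 0 then 0 else Real.sign t / t - lam q * digit q α t

/-- The integer `d₀` with `x - d₀ λ ∈ [(α - 1) λ, α λ)`; it is `0` if `x` already lies
in this interval. -/
def digitZero (q : ℕ) (α x : ℝ) : ℤ := ⌊x / lam q + 1 - α⌋

/-- `tail q α x n = T_α^n (x - d₀ λ)`. -/
def tail (q : ℕ) (α x : ℝ) (n : ℕ) : ℝ :=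
  (rosenMap q α)^[n] (x - digitZero q α x * lam q)

/-- `eps q α x n` is `ε_{n+1}(x)`. -/
def eps (q : ℕ) (α x : ℝ) (n : ℕ) : ℝ := Real.sign (tail q α x n)

/-- `dig q α x n` is `d_{n+1}(x)`. -/
def dig (q : ℕ) (α x : ℝ) (n : ℕ) : ℤ := digit q α (tail q α x n)

/-- The numerators `p_n` of the convergents
`p_n / q_n = d₀ λ + ε₁ / (d₁ λ + ε₂ / (d₂ λ + ⋯ + ε_n / (d_n λ)))`. -/
def convNum (q : ℕ) (α x : ℝ) : ℕ → ℝ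
  | 0 => digitZero q α x * lam q
  | 1 => dig q α x 0 * lam q * (digitZero q α x * lam q) + eps q α x 0
  | n + 2 => dig q α x (n + 1) * lam q * convNum q α x (n + 1)
      + eps q α x (n + 1) * convNum q α x n

/-- The denominators `q_n` of the convergents. -/
def convDen (q : ℕ) (α x : ℝ) : ℕ → ℝ
  | 0 => 1
  | 1 => dig q α x 0 * lam q
  | n + 2 => dig q α x (n + 1) * lam q * convDen q α x (n + 1)
      + eps q α x (n + 1) * convDen q α x n

/-- The approximation coefficient `Θ_n(x) = q_n² |x - p_n / q_n|`. -/
def theta (q : ℕ) (α x : ℝ) (n : ℕ) : ℝ :=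
  convDen q α x n ^ 2 * |x - convNum q α x n / convDen q α x n|

/-- The Hurwitz constant of `G_q`. -/
def hurwitzConst (q : ℕ) : ℝ :=
  if Even q then 1 / 2 else 1 / Real.sqrt (lam q ^ 2 - 4 * lam q + 8)

end

end AlphaRosen

namespace AlphaRosen

noncomputable section

/-! ### The sine sequence -/

/-! Write t_n for the tails and v_n = q_{n-1} / q_n. Then Θ_n (1 + t_n v_n) = |t_n|, so the width 1
/ Θ_n is 1 / |t_n| + ε v_n with ε the sign of t_n; read one index later, it is 1 / v_{n+1} +
t_{n+1}. If the first claim fails, all widths lie below κ = 1 / H_q from some index on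
(`WidthsBelow`).

Small widths make the orbit rigid. A positive tail satisfies t + 1 / t < κ (`t_add_inv_lt`). For q
even, κ = 2 and there is none; for q odd, κ = R + 1 / R with R² + (2 - λ) R = 1, and such a tail
exceeds R. Negative tails come in runs of the digit (-1 : 1), along which an elliptic element with
powers given by `sn` acts. At the start of a run put t = -(λ - A) and v = 1 / (λ + B); the width is
A + B. The width bounds fix the length of the run and with it the Möbius map from A to its value at
a later start. This map expands around a fixed point: A = 1 for q even, A = 1 / R for odd q ≥ 5. For
q = 3 the same happens with the constant digit (-1 : 3) and t = -(1 - R). As A is bounded, it must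
equal the fixed value (`eq_zero_of_expanding`).

It remains to exclude orbits lying exactly there. Invariant staircase bounds on v (`staircase`,
`three_staircase`) give B at least the other end point, so the width is at least κ. For odd q ≥ 5
and αλ > R, the next A' would be R, although it must exceed R in every continuation.

For sharpness, take x to be a root, up to translation by a multiple of λ, of X² - β X - 1 with β² +
4 = κ². The form a² - β a c - c² has absolute value at least 1 on all columns of the Hecke group
(`exists_extremal_form`). Convergents are such columns with error tending to 0, so Θ_n cannot stay
below any c < 1 / κ infinitely often. -/

/-- The Chebyshev-type sequence `sin (k π / q) / sin (π / q)`. -/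
def sn (q k : ℕ) : ℝ := Real.sin (k * (Real.pi / q)) / Real.sin (Real.pi / q)

lemma angle_pos {q : ℕ} (hq : 3 ≤ q) : 0 < Real.pi / q := by
  have : (3 : ℝ) ≤ q := by exact_mod_cast hq
  have := Real.pi_pos
  positivity

lemma sin_angle_pos {q : ℕ} (hq : 3 ≤ q) : 0 < Real.sin (Real.pi / q) := by
  have h3 : (3 : ℝ) ≤ q := by exact_mod_cast hq
  refine Real.sin_pos_of_pos_of_lt_pi (angle_pos hq) ?_
  rw [div_lt_iff₀ (by linarith)]
  nlinarith [Real.pi_pos]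

@[simp] lemma sn_zero (q : ℕ) : sn q 0 = 0 := by simp [sn]

lemma sn_one {q : ℕ} (hq : 3 ≤ q) : sn q 1 = 1 := by
  simp [sn, (sin_angle_pos hq).ne']

lemma sn_add_two (q k : ℕ) : sn q (k + 2) = lam q * sn q (k + 1) - sn q k := by
  have h1 : ((k + 2 : ℕ) : ℝ) * (Real.pi / q) = ((k + 1 : ℕ) : ℝ) * (Real.pi / q) + Real.pi / q := by
    push_cast; ring
  have h2 : ((k : ℕ) : ℝ) * (Real.pi / q) = ((k + 1 : ℕ) : ℝ) * (Real.pi / q) - Real.pi / q := by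
    push_cast; ring
  simp only [sn, lam]
  rw [h1, h2, Real.sin_add, Real.sin_sub]
  ring

lemma sn_pos {q k : ℕ} (hq : 3 ≤ q) (h0 : 0 < k) (hk : k < q) : 0 < sn q k := by
  have h3 : (0 : ℝ) < q := by exact_mod_cast (by omega : 0 < q)
  have hk' : (k : ℝ) < q := by exact_mod_cast hk
  have h0' : (0 : ℝ) < k := by exact_mod_cast h0
  refine div_pos (Real.sin_pos_of_pos_of_lt_pi (mul_pos h0' (angle_pos hq)) ?_) (sin_angle_pos hq)
  rw [← mul_div_assoc, div_lt_iff₀ h3]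
  nlinarith [Real.pi_pos]

lemma sn_symm {q k j : ℕ} (hq : 3 ≤ q) (h : k + j = q) : sn q k = sn q j := by
  have h3 : (q : ℝ) ≠ 0 := by exact_mod_cast (by omega : q ≠ 0)
  have hj : (k : ℝ) = q - j := by rw [← h]; push_cast; ring
  have : (k : ℝ) * (Real.pi / q) = Real.pi - j * (Real.pi / q) := by
    rw [hj]; field_simp
  simp only [sn]
  rw [this, Real.sin_pi_sub]

lemma sn_self {q : ℕ} (hq : 3 ≤ q) : sn q q = 0 := by
  rw [sn_symm hq (show q + 0 = q by omega), sn_zero]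

lemma sn_nonneg {q k : ℕ} (hq : 3 ≤ q) (hk : k ≤ q) : 0 ≤ sn q k := by
  rcases Nat.eq_zero_or_pos k with rfl | h0
  · simp
  rcases hk.eq_or_lt with rfl | h
  · exact (sn_self hq).ge
  · exact (sn_pos hq h0 h).le

lemma sn_det {q : ℕ} (hq : 3 ≤ q) (k : ℕ) : sn q (k + 1) ^ 2 - sn q (k + 2) * sn q k = 1 := by
  induction k with
  | zero => simp [sn_one hq]
  | succ k ih =>
    rw [sn_add_two q (k + 1)]
    have := sn_add_two q k
    rw [show k + 1 + 1 = k + 2 by ring, ← ih]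
    linear_combination (sn q (k + 2)) * this

lemma one_le_sn {q k : ℕ} (hq : 3 ≤ q) (h0 : 0 < k) (hk : k < q) : 1 ≤ sn q k := by
  have h3 : (0 : ℝ) < q := by exact_mod_cast (by omega : 0 < q)
  have hk' : (k : ℝ) + 1 ≤ q := by exact_mod_cast hk
  have h0' : (1 : ℝ) ≤ k := by exact_mod_cast h0
  have hθ := angle_pos hq
  have hqθ : q * (Real.pi / q) = Real.pi := by field_simp
  rw [sn, le_div_iff₀ (sin_angle_pos hq), one_mul, ← sub_nonneg, Real.sin_sub_sin]
  refine mul_nonneg (mul_nonneg zero_le_two ?_) ?_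
  · apply Real.sin_nonneg_of_nonneg_of_le_pi <;> nlinarith
  · apply Real.cos_nonneg_of_neg_pi_div_two_le_of_le <;> nlinarith

/-! ### Bounds for `λ` -/

lemma lam_lt_two {q : ℕ} (hq : 3 ≤ q) : lam q < 2 := by
  have h3 : (0 : ℝ) < q := by exact_mod_cast (by omega : 0 < q)
  have hs := sin_angle_pos hq
  have h1 := Real.sin_sq_add_cos_sq (Real.pi / q)
  have : Real.cos (Real.pi / q) < 1 := by nlinarith
  simp only [lam]; linarith

lemma lam_mono {m q : ℕ} (hm : 0 < m) (h : m ≤ q) : lam m ≤ lam q := by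
  have h3 : (0 : ℝ) < m := by exact_mod_cast hm
  have h1 : (1 : ℝ) ≤ m := by exact_mod_cast hm
  have hmq : (m : ℝ) ≤ q := by exact_mod_cast h
  have := Real.pi_pos
  simp only [lam]
  have : Real.cos (Real.pi / m) ≤ Real.cos (Real.pi / q) := by
    apply Real.cos_le_cos_of_nonneg_of_le_pi
    · positivity
    · rw [div_le_iff₀ h3]; nlinarith
    · gcongr
  linarith

lemma lam_three : lam 3 = 1 := by
  simp [lam]

lemma lam_four_sq : lam 4 ^ 2 = 2 := by
  have h := Real.cos_pi_div_four
  simp only [lam, Nat.cast_ofNat, h]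
  nlinarith [Real.sq_sqrt (show (0 : ℝ) ≤ 2 by norm_num)]

lemma one_le_lam {q : ℕ} (hq : 3 ≤ q) : 1 ≤ lam q :=
  lam_three ▸ lam_mono (by norm_num) hq

lemma two_le_lam_sq {q : ℕ} (hq : 4 ≤ q) : 2 ≤ lam q ^ 2 := by
  have h := lam_mono (by norm_num) hq
  have h1 := one_le_lam (q := 4) (by norm_num)
  nlinarith [lam_four_sq]

lemma golden_lam {q : ℕ} (hq : 5 ≤ q) : 0 ≤ lam q ^ 2 - lam q - 1 := by
  have h := lam_mono (by norm_num) hq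
  have h5 : lam 5 = (1 + √5) / 2 := by
    simp only [lam, Nat.cast_ofNat, Real.cos_pi_div_five]; ring
  have h1 := one_le_lam (q := 5) (by norm_num)
  have : lam 5 ^ 2 - lam 5 - 1 = 0 := by
    rw [h5]; nlinarith [Real.sq_sqrt (show (0 : ℝ) ≤ 5 by norm_num)]
  nlinarith

lemma three_le_lam_sq {q : ℕ} (hq : 6 ≤ q) : 3 ≤ lam q ^ 2 := by
  have h := lam_mono (by norm_num) hq
  have h1 := one_le_lam (q := 6) (by norm_num)
  have : lam 6 ^ 2 = 3 := by
    have := Real.sq_cos_pi_div_six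
    simp only [lam, Nat.cast_ofNat]; nlinarith
  nlinarith

/-! ### Corners traced by runs of the digit (-1 : 1). -/

/-- Ratios of consecutive terms decrease. -/
lemma sn_ratio_anti {q i : ℕ} (hq : 3 ≤ q) (hi : i + 1 < q) {A : ℝ}
    (h : sn q (i + 1) * A < sn q (i + 2)) : sn q i * A < sn q (i + 1) := by
  have h1 := sn_pos hq (Nat.succ_pos i) hi
  have h2 := sn_nonneg hq (show i ≤ q by omega)
  have h3 := sn_det hq i
  have h4 := mul_le_mul_of_nonneg_left h.le h2
  by_contra! hc
  have h5 := mul_le_mul_of_nonneg_left hc h1.le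
  nlinarith

/-- The image of `λ - A` under `i` steps of `s ↦ λ - 1 / s`. -/
def cornerT (q : ℕ) (A : ℝ) (i : ℕ) : ℝ :=
  (sn q (i + 2) - sn q (i + 1) * A) / (sn q (i + 1) - sn q i * A)

/-- The image of `1 / (λ + B)` under `i` steps of `v ↦ 1 / (λ - v)`. -/
def cornerV (q : ℕ) (B : ℝ) (i : ℕ) : ℝ :=
  (sn q i * B + sn q (i + 1)) / (sn q (i + 1) * B + sn q (i + 2))

lemma cornerT_zero {q : ℕ} (hq : 3 ≤ q) (A : ℝ) : cornerT q A 0 = lam q - A := by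
  have h2 := sn_add_two q 0
  simp only [zero_add, sn_zero, sn_one hq] at h2
  simp only [cornerT, zero_add, sn_zero, sn_one hq, h2]
  ring

lemma cornerV_zero {q : ℕ} (hq : 3 ≤ q) (B : ℝ) : cornerV q B 0 = 1 / (lam q + B) := by
  have h2 := sn_add_two q 0
  simp only [zero_add, sn_zero, sn_one hq] at h2
  simp only [cornerV, zero_add, sn_zero, sn_one hq, h2]
  congr 1 <;> ring

lemma cornerT_den_pos {q i : ℕ} (hq : 3 ≤ q) {A : ℝ} (hi : i + 2 ≤ q)
    (hA : sn q (i + 1) * A < sn q (i + 2)) : 0 < sn q (i + 1) - sn q i * A := by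
  have := sn_ratio_anti hq (by omega) hA
  linarith

lemma cornerT_pos {q i : ℕ} (hq : 3 ≤ q) {A : ℝ} (hi : i + 2 ≤ q)
    (hA : sn q (i + 1) * A < sn q (i + 2)) : 0 < cornerT q A i :=
  div_pos (by linarith) (cornerT_den_pos hq hi hA)

lemma cornerT_succ {q i : ℕ} (hq : 3 ≤ q) {A : ℝ} (hi : i + 2 < q)
    (hA : sn q (i + 1) * A < sn q (i + 2)) :
    cornerT q A (i + 1) = lam q - 1 / cornerT q A i := by
  have h1 := cornerT_den_pos hq hi.le hA
  have h3 := sn_add_two q (i + 1)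
  have h4 := sn_add_two q i
  have h5 : sn q (i + 2) - sn q (i + 1) * A ≠ 0 := by linarith
  simp only [cornerT, one_div_div]
  rw [show i + 1 + 2 = i + 2 + 1 by ring, show i + 1 + 1 = i + 2 by ring] at *
  rw [h3]
  field_simp
  linear_combination (-A) * h4

lemma cornerV_den_pos {q i : ℕ} (hq : 3 ≤ q) {B : ℝ} (hB : 0 ≤ B) (hi : i + 2 < q) :
    0 < sn q (i + 1) * B + sn q (i + 2) := by
  have p1 := sn_pos hq (show 0 < i + 1 by omega) (by omega)
  have p2 := sn_pos hq (show 0 < i + 2 by omega) hi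
  positivity

lemma cornerV_pos {q i : ℕ} (hq : 3 ≤ q) {B : ℝ} (hB : 0 ≤ B) (hi : i + 2 < q) :
    0 < cornerV q B i := by
  have p0 := sn_nonneg hq (show i ≤ q by omega)
  have p1 := sn_pos hq (show 0 < i + 1 by omega) (by omega)
  exact div_pos (by positivity) (cornerV_den_pos hq hB hi)

/-- The inequality is the positivity of the next denominator, which is λ times the present
denominator minus the numerator. -/
lemma cornerV_lt {q i : ℕ} (hq : 3 ≤ q) {B : ℝ} (hB : 0 ≤ B) (hi : i + 3 < q) :
    cornerV q B i < lam q := by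
  have h1 := cornerV_den_pos (i := i + 1) hq hB hi
  have h3 := sn_add_two q (i + 1)
  have h4 := sn_add_two q i
  rw [cornerV, div_lt_iff₀ (cornerV_den_pos hq hB (by omega))]
  rw [show i + 1 + 2 = i + 2 + 1 by ring, show i + 1 + 1 = i + 2 by ring] at *
  rw [h3] at h1
  rw [h4] at h1 ⊢
  nlinarith

lemma cornerV_succ {q i : ℕ} (hq : 3 ≤ q) {B : ℝ} (hB : 0 ≤ B) (hi : i + 3 < q) :
    cornerV q B (i + 1) = 1 / (lam q - cornerV q B i) := by
  have h0 := cornerV_den_pos (i := i) hq hB (by omega)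
  have h1 := cornerV_den_pos (i := i + 1) hq hB hi
  have h2 := cornerV_lt hq hB hi
  have h3 := sn_add_two q (i + 1)
  have h4 := sn_add_two q i
  rw [eq_div_iff (by linarith)]
  simp only [cornerV]
  rw [show i + 1 + 2 = i + 2 + 1 by ring, show i + 1 + 1 = i + 2 by ring] at *
  rw [div_mul_eq_mul_div, div_eq_iff h1.ne', sub_div' h0.ne', mul_div_assoc', div_eq_iff h0.ne']
  rw [h3]
  linear_combination (-(sn q (i + 1) * B + sn q (i + 2)) * B) * h4

/-- This is the quantity `A'` with which a run is left after `i` steps, as needed in `run_exit`. -/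
lemma inv_cornerT_sub {q i : ℕ} {A : ℝ} (hA : sn q (i + 1) * A < sn q (i + 2)) :
    1 / cornerT q A i - lam q =
      (sn q (i + 2) * A - sn q (i + 3)) / (sn q (i + 2) - sn q (i + 1) * A) := by
  have h3 := sn_add_two q (i + 1)
  have h4 := sn_add_two q i
  rw [show i + 1 + 2 = i + 3 by ring, show i + 1 + 1 = i + 2 by ring] at h3
  have h5 : sn q (i + 2) - sn q (i + 1) * A ≠ 0 := by linarith
  rw [cornerT, one_div_div, div_sub' h5]
  congr 1
  linear_combination h3 + A * (-1) * h4

end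

end AlphaRosen

namespace AlphaRosen

/-! ### Orbits of the natural extension -/

/-- A two-sided orbit of the `α`-Rosen map: `t` is a sequence of nonzero tails, `d` the sequence
of digits, and `v` the sequence of quotients of consecutive denominators. -/
structure RosenOrbit (q : ℕ) (α : ℝ) (t v : ℕ → ℝ) (d : ℕ → ℤ) : Prop where
  three_le : 3 ≤ q
  half_le : 1 / 2 ≤ α
  mul_le_one : α * lam q ≤ 1
  le_t : ∀ n, (α - 1) * lam q ≤ t n
  t_lt : ∀ n, t n < α * lam q
  t_ne : ∀ n, t n ≠ 0
  one_le_d : ∀ n, 1 ≤ d n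
  v_zero : v 0 = 0
  pos : ∀ n, 0 < t n → t (n + 1) = 1 / t n - d n * lam q ∧ v (n + 1) = 1 / (d n * lam q + v n)
  neg : ∀ n, t n < 0 →
    t (n + 1) = 1 / (-t n) - d n * lam q ∧ v (n + 1) = 1 / (d n * lam q - v n)

/-- The `v`-coordinates of an orbit lie in `[0, 1]`, and vanish at most initially. -/
def UnitBounded (v : ℕ → ℝ) : Prop := ∀ n, 0 ≤ v n ∧ v n ≤ 1 ∧ 0 < v (n + 1)

/-- The reciprocal approximation coefficients are smaller than `κ` from the index `N` on. -/
def WidthsBelow (t v : ℕ → ℝ) (κ : ℝ) (N : ℕ) : Prop :=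
  ∀ n, N ≤ n → (0 < t n → 1 / t n + v n < κ) ∧ (t n < 0 → 1 / (-t n) - v n < κ)

lemma int_eq_of_mul_mem {l a x : ℝ} {d m : ℤ} (hl : 0 < l) (h1 : (a - 1) * l ≤ x - d * l)
    (h2 : x - d * l < a * l) (h3 : (a - 1) * l ≤ x - m * l) (h4 : x - m * l < a * l) : d = m := by
  have h5 : ((d : ℝ) - m) * l < 1 * l := by linarith
  have h6 : ((m : ℝ) - d) * l < 1 * l := by linarith
  have h7 := lt_of_mul_lt_mul_right h5 hl.le
  have h8 := lt_of_mul_lt_mul_right h6 hl.le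
  have h9 : d - m < 1 := by exact_mod_cast h7
  have h10 : m - d < 1 := by exact_mod_cast h8
  omega

lemma exists_pow_gt {c K x : ℝ} (hc : 1 < c) (hx : 0 < x) : ∃ m : ℕ, K < c ^ m * x := by
  obtain ⟨m, hm⟩ := pow_unbounded_of_one_lt (K / x) hc
  exact ⟨m, by rwa [div_lt_iff₀ hx] at hm⟩

/-- A bounded quantity that is expanded along a set of indices vanishes there. -/
lemma eq_zero_of_expanding {P : ℕ → Prop} {D : ℕ → ℝ} {c K : ℝ} (hc : 1 < c)
    (hD : ∀ n, P n → |D n| ≤ K) (hP : ∀ n, P n → ∃ m, P m ∧ c * |D n| ≤ |D m|) :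
    ∀ n, P n → D n = 0 := by
  intro n hn
  by_contra hne
  have hpos : 0 < |D n| := abs_pos.mpr hne
  obtain ⟨m, hm⟩ := exists_pow_gt (K := K) hc hpos
  have key : ∀ m : ℕ, ∃ k, P k ∧ c ^ m * |D n| ≤ |D k| := by
    intro m
    induction m with
    | zero => exact ⟨n, hn, by simp⟩
    | succ m ih =>
      obtain ⟨k, hk, hk'⟩ := ih
      obtain ⟨k', hk1, hk2⟩ := hP k hk
      refine ⟨k', hk1, le_trans ?_ hk2⟩
      rw [pow_succ']
      nlinarith
  obtain ⟨k, hk, hk'⟩ := key m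
  linarith [hD k hk]

namespace RosenOrbit

variable {q : ℕ} {α : ℝ} {t v : ℕ → ℝ} {d : ℕ → ℤ}

lemma lam_pos (h : RosenOrbit q α t v d) : 0 < lam q := by linarith [one_le_lam h.three_le]

lemma t_lt_one (h : RosenOrbit q α t v d) (n : ℕ) : t n < 1 := (h.t_lt n).trans_le h.mul_le_one

lemma neg_half_le (h : RosenOrbit q α t v d) (n : ℕ) : -(lam q / 2) ≤ t n := by
  nlinarith [h.le_t n, h.half_le, h.lam_pos]

lemma d_mul_ge (h : RosenOrbit q α t v d) (n : ℕ) : lam q ≤ d n * lam q := by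
  have : (1 : ℝ) ≤ d n := by exact_mod_cast h.one_le_d n
  nlinarith [h.lam_pos]

lemma d_mul_ge_two (h : RosenOrbit q α t v d) {n : ℕ} (hd : d n ≠ 1) : 2 * lam q ≤ d n * lam q := by
  have h1 := h.one_le_d n
  have : (2 : ℝ) ≤ d n := by exact_mod_cast (by omega : 2 ≤ d n)
  nlinarith [h.lam_pos]

lemma d_mul_ge_three (h : RosenOrbit q α t v d) {n : ℕ} (hd : d n ≠ 1) (hd' : d n ≠ 2) :
    3 * lam q ≤ d n * lam q := by
  have h1 := h.one_le_d n
  have : (3 : ℝ) ≤ d n := by exact_mod_cast (by omega : 3 ≤ d n)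
  nlinarith [h.lam_pos]

lemma digit_of_pos (h : RosenOrbit q α t v d) {n : ℕ} (ht : 0 < t n) {m : ℤ}
    (h1 : (α - 1) * lam q ≤ 1 / t n - m * lam q) (h2 : 1 / t n - m * lam q < α * lam q) :
    d n = m := by
  have h3 := h.le_t (n + 1)
  have h4 := h.t_lt (n + 1)
  rw [(h.pos n ht).1] at h3 h4
  exact int_eq_of_mul_mem h.lam_pos h3 h4 h1 h2

lemma digit_of_neg (h : RosenOrbit q α t v d) {n : ℕ} (ht : t n < 0) {m : ℤ}
    (h1 : (α - 1) * lam q ≤ 1 / (-t n) - m * lam q)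
    (h2 : 1 / (-t n) - m * lam q < α * lam q) : d n = m := by
  have h3 := h.le_t (n + 1)
  have h4 := h.t_lt (n + 1)
  rw [(h.neg n ht).1] at h3 h4
  exact int_eq_of_mul_mem h.lam_pos h3 h4 h1 h2

/-- Negative tails beyond `-1 / λ` have digit `1` and a negative successor. -/
lemma step_of_lt (h : RosenOrbit q α t v d) {n : ℕ} {s : ℝ} (ht : t n = -s) (hs0 : 0 < s)
    (hs : 1 < lam q * s) : t (n + 1) = -(lam q - 1 / s) ∧ v (n + 1) = 1 / (lam q - v n) := by
  have hn : t n < 0 := by linarith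
  have hl := h.lam_pos
  have hinv : 1 / s < lam q := by rwa [div_lt_iff₀ hs0]
  have hss : s * (1 / s) = 1 := by field_simp
  have hd : d n = 1 := by
    apply h.digit_of_neg hn
    · rw [ht]
      have h1 := h.le_t n
      have h2 := lam_lt_two h.three_le
      -- The digit is 1 once 1 / s ≥ αλ; this follows from 1 / s ≥ 2 - s, s ≤ (1 - α) λ and λ < 2.
      have : 2 ≤ s + 1 / s := by
        have : 0 < 1 / s := by positivity
        nlinarith [sq_nonneg (s - 1 / s)]
      push_cast
      rw [neg_neg]
      linarith
    · rw [ht, neg_neg]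
      push_cast
      nlinarith [h.half_le]
  have h3 := h.neg n hn
  rw [hd, ht, neg_neg] at h3
  push_cast at h3
  rw [one_mul] at h3
  exact ⟨by rw [h3.1]; ring, h3.2⟩

lemma inv_v_pos (h : RosenOrbit q α t v d) {n : ℕ} (ht : 0 < t n) :
    1 / v (n + 1) = d n * lam q + v n := by
  rw [(h.pos n ht).2, one_div_one_div]

lemma inv_v_neg (h : RosenOrbit q α t v d) {n : ℕ} (ht : t n < 0) :
    1 / v (n + 1) = d n * lam q - v n := by
  rw [(h.neg n ht).2, one_div_one_div]

/-- The width at an index, seen from the next index. -/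
lemma inv_v_add_t_lt (h : RosenOrbit q α t v d) {κ : ℝ} {N n : ℕ} (hb : WidthsBelow t v κ N)
    (hn : N ≤ n) : 1 / v (n + 1) + t (n + 1) < κ := by
  rcases (h.t_ne n).lt_or_gt with ht | ht
  · have := (hb n hn).2 ht
    rw [h.inv_v_neg ht, (h.neg n ht).1]; linarith
  · have := (hb n hn).1 ht
    rw [h.inv_v_pos ht, (h.pos n ht).1]; linarith

/-- Both 1 / t + v and 1 / v + t are widths. Multiplying the resulting bounds for v and 1 / v
eliminates v, and symmetrically t. -/
lemma t_add_inv_lt (h : RosenOrbit q α t v d) {κ : ℝ} {N n : ℕ} (hb : WidthsBelow t v κ N)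
    (hv : UnitBounded v) (hn : N ≤ n) (ht : 0 < t (n + 1)) :
    t (n + 1) + 1 / t (n + 1) < κ ∧ v (n + 1) + 1 / v (n + 1) < κ := by
  have h1 := h.inv_v_add_t_lt hb hn
  have h2 := (hb (n + 1) (by omega)).1 ht
  have hv1 := (hv n).2.2
  set x := t (n + 1)
  set y := v (n + 1)
  have hx : x * (1 / x) = 1 := by field_simp
  have hy : y * (1 / y) = 1 := by field_simp
  have hxi : 0 < 1 / x := by positivity
  have hyi : 0 < 1 / y := by positivity
  have hκ : 0 < κ := by linarith
  constructor
  · have : 1 < (κ - 1 / x) * (κ - x) := by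
      have := mul_lt_mul'' (show y < κ - 1 / x by linarith) (show 1 / y < κ - x by linarith)
        hv1.le hyi.le
      rwa [hy] at this
    nlinarith
  · have : 1 < (κ - 1 / y) * (κ - y) := by
      have := mul_lt_mul'' (show x < κ - 1 / y by linarith) (show 1 / x < κ - y by linarith)
        ht.le hxi.le
      rwa [hx] at this
    nlinarith

/-! ### Runs of the digit `(-1 : 1)` -/

/-- The hypothesis on `A` says that corner `i` is positive. By `sn_ratio_anti` all earlier corners
are positive as well, and positivity of the next corner is exactly the condition of `step_of_lt`. -/
lemma run (h : RosenOrbit q α t v d) {n : ℕ} {A : ℝ} (ht : t n = -(lam q - A)) (i : ℕ)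
    (hi : i + 2 ≤ q) (hA : sn q (i + 1) * A < sn q (i + 2)) :
    t (n + i) = -cornerT q A i ∧
      ∀ j < i, t (n + j + 1) = -(lam q - 1 / cornerT q A j) ∧
        v (n + j + 1) = 1 / (lam q - v (n + j)) := by
  induction i with
  | zero => exact ⟨by rw [cornerT_zero h.three_le, add_zero, ht], by simp⟩
  | succ i ih =>
    have hA' := sn_ratio_anti h.three_le (by omega) hA
    obtain ⟨h2, h3⟩ := ih (by omega) hA'
    have hp := cornerT_pos h.three_le (by omega) hA'
    have hp' := cornerT_pos h.three_le hi hA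
    rw [cornerT_succ h.three_le (by omega) hA'] at hp' ⊢
    have h6 := h.step_of_lt h2 hp (by rwa [sub_pos, div_lt_iff₀ hp] at hp')
    refine ⟨h6.1, fun j hj => ?_⟩
    rcases Nat.lt_succ_iff_lt_or_eq.mp hj with hj | rfl
    · exact h3 j hj
    · exact h6

lemma run_v_le (h : RosenOrbit q α t v d) {n : ℕ} {A B : ℝ}
    (ht : t n = -(lam q - A)) (hB : 0 ≤ B) (hvn : v n ≤ 1 / (lam q + B)) (i : ℕ)
    (hi : i + 2 < q) (hA : sn q (i + 1) * A < sn q (i + 2)) :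
    v (n + i) ≤ cornerV q B i := by
  induction i with
  | zero => rwa [cornerV_zero h.three_le]
  | succ i ih =>
    have hA' := sn_ratio_anti h.three_le (by omega) hA
    have h0 := ih (by omega) hA'
    have h6 := ((h.run ht (i + 1) (by omega) hA).2 i (by omega)).2
    rw [show n + (i + 1) = n + i + 1 by ring, h6, cornerV_succ h.three_le hB (by omega)]
    have hlt := cornerV_lt h.three_le hB (show i + 3 < q by omega)
    exact one_div_le_one_div_of_le (by linarith) (by linarith)

end RosenOrbit

end AlphaRosen

namespace AlphaRosen

/-! ### The staircase bounds for `v` -/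

/-- A staircase of corners following `K` digits `(-1 : 1)`, from the geodesic with end points
`A` and `-B` to the one with end points `A'` and `-B'`. -/
structure CornerChain (l A B A' B' : ℝ) (K : ℕ) (σ τ : ℕ → ℝ) : Prop where
  σ_zero : σ 0 = l - A
  τ_zero : τ 0 = 1 / (l + B)
  σ_end : σ K = 1 / (l + A')
  τ_end : τ K = l - B'
  σ_pos : ∀ i ≤ K, 0 < σ i
  σ_succ : ∀ i < K, σ (i + 1) = l - 1 / σ i
  τ_nonneg : ∀ i ≤ K, 0 ≤ τ i
  τ_lt : ∀ i < K, τ i < l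
  τ_succ : ∀ i < K, τ (i + 1) = 1 / (l - τ i)

lemma cornerChain_corner {q K : ℕ} {A B A' B' : ℝ} (hq : 3 ≤ q) (hK : K + 2 < q) (hB : 0 ≤ B)
    (hA : sn q (K + 1) * A < sn q (K + 2)) (hA' : cornerT q A K = 1 / (lam q + A'))
    (hB' : cornerV q B K = lam q - B') :
    CornerChain (lam q) A B A' B' K (cornerT q A) (cornerV q B) := by
  have key : ∀ j ≤ K, sn q (K - j + 1) * A < sn q (K - j + 2) := by
    intro j
    induction j with
    | zero => intro _; simpa using hA
    | succ j ih =>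
      intro hj
      have := ih (by omega)
      rw [show K - j = K - (j + 1) + 1 by omega] at this
      exact sn_ratio_anti hq (by omega) this
  have key' : ∀ i ≤ K, sn q (i + 1) * A < sn q (i + 2) := by
    intro i hi
    have := key (K - i) (by omega)
    rwa [show K - (K - i) = i by omega] at this
  exact
    { σ_zero := cornerT_zero hq A
      τ_zero := cornerV_zero hq B
      σ_end := hA'
      τ_end := hB'
      σ_pos := fun i hi => cornerT_pos hq (by omega) (key' i hi)
      σ_succ := fun i hi => cornerT_succ hq (by omega) (key' i hi.le)
      τ_nonneg := fun i hi => (cornerV_pos hq hB (by omega)).le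
      τ_lt := fun i hi => cornerV_lt hq hB (by omega)
      τ_succ := fun i hi => cornerV_succ hq hB (by omega) }

lemma CornerChain.inv_le_τ {l A B A' B' : ℝ} {K : ℕ} {σ τ : ℕ → ℝ}
    (hc : CornerChain l A B A' B' K σ τ) {i : ℕ} (hi : i < K) : 1 / l ≤ τ (i + 1) := by
  rw [hc.τ_succ i hi]
  exact one_div_le_one_div_of_le (by linarith [hc.τ_lt i hi]) (by linarith [hc.τ_nonneg i hi.le])

namespace RosenOrbit

variable {q : ℕ} {α : ℝ} {t v : ℕ → ℝ} {d : ℕ → ℤ}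

/-- Only the digit (-1 : 1) can bring v above 1 / λ, while every corner after the first has height
at least 1 / λ; hence other digits need no attention there. -/
lemma v_succ_le_inv_lam (h : RosenOrbit q α t v d) {n : ℕ} (h0 : 0 ≤ v n) (h1 : v n ≤ 1)
    (hn : ¬ (t n < 0 ∧ d n = 1)) : v (n + 1) ≤ 1 / lam q := by
  have hl := h.lam_pos
  have hl1 := one_le_lam h.three_le
  rcases (h.t_ne n).lt_or_gt with ht | ht
  · rw [(h.neg n ht).2]
    have := h.d_mul_ge_two (fun hd => hn ⟨ht, hd⟩)
    exact one_div_le_one_div_of_le hl (by linarith)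
  · rw [(h.pos n ht).2]
    have := h.d_mul_ge n
    exact one_div_le_one_div_of_le hl (by linarith)

/-- Position of a negative tail in terms of its successor. -/
lemma neg_t_eq (h : RosenOrbit q α t v d) {n : ℕ} (ht : t n < 0) :
    0 < d n * lam q + t (n + 1) ∧ -t n = 1 / (d n * lam q + t (n + 1)) := by
  rw [(h.neg n ht).1]
  have : 0 < 1 / (-t n) := by rw [one_div_pos]; linarith
  constructor
  · linarith
  · rw [add_sub_cancel, one_div_one_div]

lemma t_eq (h : RosenOrbit q α t v d) {n : ℕ} (ht : 0 < t n) :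
    0 < d n * lam q + t (n + 1) ∧ t n = 1 / (d n * lam q + t (n + 1)) := by
  rw [(h.pos n ht).1]
  have : 0 < 1 / t n := by rw [one_div_pos]; linarith
  constructor
  · linarith
  · rw [add_sub_cancel, one_div_one_div]

/-- Invariance of one staircase. Corner `i + 1` pulls back under (-1 : 1) to corner `i`; corner 0
pulls back under (-1 : 2) to the last corner of the chain ending in `A`, `B`, which is `hprev`. The
digit 1 cannot lead to corner 0: it would force |t n| ≥ 1 / A ≥ R, against -λ / 2 ≤ t n < αλ. -/
lemma chain_step (h : RosenOrbit q α t v d) {R A B A' B' : ℝ} {K : ℕ} {σ τ : ℕ → ℝ}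
    (hc : CornerChain (lam q) A B A' B' K σ τ) (hR : α * lam q ≤ R) (hR' : lam q / 2 < R)
    (hA0 : 0 < A) (hA : A * R ≤ 1) (hB0 : 0 < B) (hB : B ≤ lam q) {n : ℕ}
    (hprev : t n ≤ -(1 / (lam q + A)) → v n ≤ lam q - B) (h0 : 0 ≤ v n) (h1 : v n ≤ 1)
    (ih : ∀ i ≤ K, t n ≤ -σ i → v n ≤ τ i) :
    ∀ i ≤ K, t (n + 1) ≤ -σ i → v (n + 1) ≤ τ i := by
  have hl := h.lam_pos
  have hl1 := one_le_lam h.three_le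
  have hRA : R ≤ 1 / A := by rw [le_div_iff₀ hA0]; linarith
  intro i hi hti
  rcases i with _ | i
  · rw [hc.σ_zero] at hti
    rw [hc.τ_zero]
    have hlB : 0 < lam q + B := by linarith
    rcases (h.t_ne n).lt_or_gt with ht | ht
    · obtain ⟨e0, e1⟩ := h.neg_t_eq ht
      by_cases hd1 : d n = 1
      · exfalso
        rw [hd1] at e0 e1
        push_cast at e0 e1
        have := one_div_le_one_div_of_le e0 (show 1 * lam q + t (n + 1) ≤ A by linarith)
        linarith [h.neg_half_le n]
      rw [(h.neg n ht).2]
      by_cases hd2 : d n = 2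
      · rw [hd2] at e0 e1 ⊢
        push_cast at e0 e1 ⊢
        have := one_div_le_one_div_of_le e0 (show 2 * lam q + t (n + 1) ≤ lam q + A by linarith)
        have := hprev (by linarith)
        exact one_div_le_one_div_of_le hlB (by linarith)
      · have := h.d_mul_ge_three hd1 hd2
        exact one_div_le_one_div_of_le hlB (by linarith)
    · obtain ⟨e0, e1⟩ := h.t_eq ht
      by_cases hd1 : d n = 1
      · exfalso
        rw [hd1] at e0 e1
        push_cast at e0 e1
        have := one_div_le_one_div_of_le e0 (show 1 * lam q + t (n + 1) ≤ A by linarith)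
        linarith [h.t_lt n]
      rw [(h.pos n ht).2]
      have := h.d_mul_ge_two hd1
      exact one_div_le_one_div_of_le hlB (by linarith)
  · by_cases hn : t n < 0 ∧ d n = 1
    · obtain ⟨ht, hd⟩ := hn
      obtain ⟨e0, e1⟩ := h.neg_t_eq ht
      have hv := (h.neg n ht).2
      rw [hd] at e0 e1 hv
      push_cast at e0 e1 hv
      rw [one_mul] at e0 e1 hv
      have hs := hc.σ_pos i (by omega)
      rw [hc.σ_succ i (by omega)] at hti
      have := one_div_le_one_div_of_le e0 (show lam q + t (n + 1) ≤ 1 / σ i by linarith)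
      rw [one_div_one_div] at this
      have := ih i (by omega) (by linarith)
      rw [hv, hc.τ_succ i (by omega)]
      have := hc.τ_lt i (by omega)
      exact one_div_le_one_div_of_le (by linarith) (by linarith)
    · exact (h.v_succ_le_inv_lam h0 h1 hn).trans (hc.inv_le_τ (by omega))

/-- The staircase bounds, when the positive tails stay below `R`. -/
lemma staircase (h : RosenOrbit q α t v d) {R : ℝ} {K L : ℕ} {σ τ σ' τ' : ℕ → ℝ}
    (hR1 : R ≤ 1) (hR : α * lam q ≤ R) (hR' : lam q / 2 < R) (hlR : 1 ≤ lam q * R)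
    (hR2 : 1 ≤ (2 * lam q - R) * R)
    (hc : CornerChain (lam q) R (1 / R) (1 / R) R K σ τ)
    (hc' : CornerChain (lam q) (1 / R) R R (1 / R) L σ' τ') (n : ℕ) :
    (0 ≤ v n ∧ v n ≤ R ∧ 0 < v (n + 1)) ∧
      (∀ i ≤ K, t n ≤ -σ i → v n ≤ τ i) ∧ (∀ i ≤ L, t n ≤ -σ' i → v n ≤ τ' i) := by
  have hl := h.lam_pos
  have hl1 := one_le_lam h.three_le
  have hR0 : 0 < R := by linarith
  have hRi : 1 / R ≤ lam q := by rwa [div_le_iff₀ hR0]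
  have den : ∀ m, 0 ≤ v m → v m ≤ R → (∀ i ≤ L, t m ≤ -σ' i → v m ≤ τ' i) →
      0 < v (m + 1) ∧ v (m + 1) ≤ R := by
    intro m h0 h1 h2
    have hRR : 0 < 1 / R := by positivity
    suffices ∃ D, 1 / R ≤ D ∧ v (m + 1) = 1 / D by
      obtain ⟨D, hD, e⟩ := this
      rw [e]
      refine ⟨one_div_pos.mpr (by linarith), ?_⟩
      rw [div_le_iff₀ (by linarith)]
      rw [div_le_iff₀ hR0] at hD
      linarith
    rcases (h.t_ne m).lt_or_gt with ht | ht
    · refine ⟨_, ?_, (h.neg m ht).2⟩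
      by_cases hd : d m = 1
      · obtain ⟨e0, e1⟩ := h.neg_t_eq ht
        rw [hd] at e0 e1 ⊢
        push_cast at e0 e1 ⊢
        rw [one_mul] at e0 e1 ⊢
        -- Since t (m + 1) < R, the point lies beyond the last corner of the second chain, which
        -- yields λ - v m ≥ 1 / R.
        have h3 := h.t_lt (m + 1)
        have h4 := one_div_le_one_div_of_le e0 (show lam q + t (m + 1) ≤ lam q + R by linarith)
        have h5 := h2 L le_rfl (by rw [hc'.σ_end]; linarith)
        rw [hc'.τ_end] at h5
        linarith
      · have := h.d_mul_ge_two hd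
        have : 1 / R ≤ 2 * lam q - R := by rwa [div_le_iff₀ hR0]
        linarith
    · refine ⟨_, ?_, (h.pos m ht).2⟩
      have := h.d_mul_ge m
      linarith
  induction n with
  | zero =>
    have h1 : ∀ i ≤ K, t 0 ≤ -σ i → v 0 ≤ τ i := by
      intro i hi _; rw [h.v_zero]; exact hc.τ_nonneg i hi
    have h2 : ∀ i ≤ L, t 0 ≤ -σ' i → v 0 ≤ τ' i := by
      intro i hi _; rw [h.v_zero]; exact hc'.τ_nonneg i hi
    exact ⟨⟨h.v_zero.ge, by rw [h.v_zero]; exact hR0.le,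
      (den 0 h.v_zero.ge (by rw [h.v_zero]; exact hR0.le) h2).1⟩, h1, h2⟩
  | succ n ih =>
    obtain ⟨⟨i0, i1, i2⟩, i3, i4⟩ := ih
    have hp := (den n i0 i1 i4).2
    -- The two chains feed each other: the end parameters of one are the initial parameters of the
    -- other.
    have h1 := h.chain_step hc hR hR' hR0 (by nlinarith) (by positivity) hRi
      (fun hh => by
        have := i4 L le_rfl (by rwa [hc'.σ_end])
        rwa [hc'.τ_end] at this) i0 (by linarith) i3
    have h2 := h.chain_step hc' hR hR' (by positivity) (by field_simp; rfl) hR0 (by linarith)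
      (fun hh => by
        have := i3 K le_rfl (by rwa [hc.σ_end])
        rwa [hc.τ_end] at this) i0 (by linarith) i4
    exact ⟨⟨i2.le, hp, (den (n + 1) i2.le hp h2).1⟩, h1, h2⟩

/-- For odd indices `q`, a chain of corners bounds `v` by `1` for all parameters. -/
lemma unitBounded_of_chain (h : RosenOrbit q α t v d) {K : ℕ} {σ τ : ℕ → ℝ}
    (hc : CornerChain (lam q) (2 / lam q) 0 1 1 K σ τ) : UnitBounded v := by
  have hl := h.lam_pos
  have hl1 := one_le_lam h.three_le
  have den : ∀ m, 0 ≤ v m → v m ≤ 1 → (∀ i ≤ K, t m < -σ i → v m ≤ τ i) →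
      0 < v (m + 1) ∧ v (m + 1) ≤ 1 := by
    intro m h0 h1 h2
    suffices ∃ D, 1 ≤ D ∧ v (m + 1) = 1 / D by
      obtain ⟨D, hD, e⟩ := this
      rw [e]
      exact ⟨one_div_pos.mpr (by linarith), by rw [div_le_iff₀ (by linarith)]; linarith⟩
    rcases (h.t_ne m).lt_or_gt with ht | ht
    · refine ⟨_, ?_, (h.neg m ht).2⟩
      by_cases hd : d m = 1
      · obtain ⟨e0, e1⟩ := h.neg_t_eq ht
        rw [hd] at e0 e1 ⊢
        push_cast at e0 e1 ⊢
        rw [one_mul] at e0 e1 ⊢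
        have h3 := h.t_lt_one (m + 1)
        have h4 := one_div_lt_one_div_of_lt e0 (show lam q + t (m + 1) < lam q + 1 by linarith)
        have h5 := h2 K le_rfl (by rw [hc.σ_end]; linarith)
        rw [hc.τ_end] at h5
        linarith
      · have := h.d_mul_ge_two hd
        linarith
    · refine ⟨_, ?_, (h.pos m ht).2⟩
      have := h.d_mul_ge m
      linarith
  have key : ∀ n, (0 ≤ v n ∧ v n ≤ 1 ∧ 0 < v (n + 1)) ∧ (∀ i ≤ K, t n < -σ i → v n ≤ τ i) := by
    intro n
    induction n with
    | zero =>
      have h1 : ∀ i ≤ K, t 0 < -σ i → v 0 ≤ τ i := by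
        intro i hi _; rw [h.v_zero]; exact hc.τ_nonneg i hi
      have h2 := h.v_zero
      exact ⟨⟨by linarith, by linarith, (den 0 (by linarith) (by linarith) h1).1⟩, h1⟩
    | succ n ih =>
      obtain ⟨⟨i0, i1, i2⟩, i3⟩ := ih
      have hp := (den n i0 i1 i3).2
      have h1 : ∀ i ≤ K, t (n + 1) < -σ i → v (n + 1) ≤ τ i := by
        intro i hi hti
        by_cases hn : t n < 0 ∧ d n = 1
        · obtain ⟨ht, hd⟩ := hn
          obtain ⟨e0, e1⟩ := h.neg_t_eq ht
          have hv := (h.neg n ht).2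
          rw [hd] at e0 e1 hv
          push_cast at e0 e1 hv
          rw [one_mul] at e0 e1 hv
          rcases i with _ | i
          -- As t n ≥ -λ / 2, the digit (-1 : 1) leads to a tail at least -(λ - 2 / λ). The corner
          -- conditions are strict because the value -λ / 2 is allowed.
          · exfalso
            rw [hc.σ_zero] at hti
            have := one_div_lt_one_div_of_lt e0 (show lam q + t (n + 1) < 2 / lam q by linarith)
            rw [one_div_div] at this
            linarith [h.neg_half_le n]
          · have hs := hc.σ_pos i (by omega)
            rw [hc.σ_succ i (by omega)] at hti
            have := one_div_lt_one_div_of_lt e0 (show lam q + t (n + 1) < 1 / σ i by linarith)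
            rw [one_div_one_div] at this
            have := i3 i (by omega) (by linarith)
            rw [hv, hc.τ_succ i (by omega)]
            have := hc.τ_lt i (by omega)
            exact one_div_le_one_div_of_le (by linarith) (by linarith)
        · refine (h.v_succ_le_inv_lam i0 i1 hn).trans ?_
          rcases i with _ | i
          · rw [hc.τ_zero, add_zero]
          · exact hc.inv_le_τ (by omega)
      exact ⟨⟨i2.le, hp, (den (n + 1) i2.le hp h1).1⟩, h1⟩
  exact fun n => (key n).1

end RosenOrbit

end AlphaRosen

namespace AlphaRosen

namespace RosenOrbit

variable {q : ℕ} {α : ℝ} {t v : ℕ → ℝ} {d : ℕ → ℤ}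

/-! ### Starts of runs -/

/-- By s + 1 / s ≥ 2, each digit (-1 : 1) lowers |t| by at least 2 - λ > 0, so a run is finite. -/
lemma exists_run_end (h : RosenOrbit q α t v d) {n : ℕ} (hn : t n < 0) :
    ∃ m, n ≤ m ∧ t m < 0 ∧ lam q * (-t m) ≤ 1 := by
  by_contra! hc
  have h2 := lam_lt_two h.three_le
  have key : ∀ k : ℕ, t (n + k) < 0 ∧ -t (n + k) ≤ -t n - k * (2 - lam q) := by
    intro k
    induction k with
    | zero => exact ⟨hn, by simp⟩
    | succ k ih =>
      have h3 := hc (n + k) (by omega) ih.1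
      have hs : 0 < -t (n + k) := by linarith [ih.1]
      have h4 := (h.step_of_lt (neg_neg _).symm hs h3).1
      have h5 : 1 / (-t (n + k)) < lam q := by rwa [div_lt_iff₀ hs]
      have h6 : 2 ≤ -t (n + k) + 1 / (-t (n + k)) := by
        have h7 : -t (n + k) * (1 / (-t (n + k))) = 1 := by
          rw [mul_one_div, div_self hs.ne']
        have : 0 < 1 / (-t (n + k)) := by positivity
        nlinarith [sq_nonneg (-t (n + k) - 1 / (-t (n + k)))]
      rw [show n + (k + 1) = n + k + 1 by ring, h4]
      push_cast
      constructor
      · linarith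
      · linarith [ih.2]
  obtain ⟨k, hk⟩ := exists_nat_gt (-t n / (2 - lam q))
  rw [div_lt_iff₀ (by linarith)] at hk
  linarith [(key k).1, (key k).2]

/-- Here 1 / |t m| ≥ λ, so the digit 1 would make the successor nonnegative. The digit is therefore
at least 2, and v m ≤ 1 leaves a denominator of at least 2λ - 1. -/
lemma after_run_end (h : RosenOrbit q α t v d) (hv : UnitBounded v) {m : ℕ} (hm : t m < 0)
    (hs : lam q * (-t m) ≤ 1) (hneg : t (m + 1) < 0) :
    v (m + 1) ≤ 1 / (lam q + (lam q - 1)) := by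
  have hl1 := one_le_lam h.three_le
  have hd : d m ≠ 1 := by
    intro hd
    have h1 := (h.neg m hm).1
    have h2 : lam q ≤ 1 / (-t m) := by rwa [le_div_iff₀ (by linarith)]
    rw [hd] at h1
    push_cast at h1
    linarith
  have := h.d_mul_ge_two hd
  rw [(h.neg m hm).2]
  exact one_div_le_one_div_of_le (by linarith) (by linarith [(hv m).2.1])

/-- If no tail is positive, there are arbitrarily late starts of runs. -/
lemma exists_start_of_neg (h : RosenOrbit q α t v d) (hv : UnitBounded v) {N : ℕ}
    (hneg : ∀ n, N ≤ n → t n < 0) :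
    ∃ m, N < m ∧ t m < 0 ∧ v m ≤ 1 / (lam q + (lam q - 1)) := by
  obtain ⟨m, hm, h1, h2⟩ := h.exists_run_end (hneg N le_rfl)
  exact ⟨m + 1, by omega, hneg _ (by omega), h.after_run_end hv h1 h2 (hneg _ (by omega))⟩

/-- In the frame of the start of a run, `B ≥ λ - 1`. -/
lemma start_bound (h : RosenOrbit q α t v d) (hv : UnitBounded v) {κ : ℝ} {N n : ℕ}
    (hb : WidthsBelow t v κ N) (hn : N < n) (hvn : v n ≤ 1 / (lam q + (lam q - 1))) :
    lam q + t n + (lam q - 1) < κ := by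
  obtain ⟨n, rfl⟩ : ∃ k, n = k + 1 := ⟨n - 1, by omega⟩
  have h1 := h.inv_v_add_t_lt hb (by omega : N ≤ n)
  have h2 := one_div_le_one_div_of_le (hv n).2.2 hvn
  rw [one_div_one_div] at h2
  linarith

/-- The two possible continuations at the end of a run: `1 / s = λ + A'`. -/
lemma run_exit (h : RosenOrbit q α t v d) {m : ℕ} {s A' : ℝ} (hs : 0 < s) (ht : t m = -s)
    (hA : 1 / s - lam q = A') (hA0 : 0 ≤ A') :
    (A' < α * lam q → t (m + 1) = A' ∧ 0 < t (m + 1)) ∧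
      (α * lam q ≤ A' → A' < lam q → t (m + 1) = -(lam q - A') ∧
        v (m + 1) = 1 / (2 * lam q - v m)) := by
  have hl := h.lam_pos
  have hneg : t m < 0 := by linarith
  have e := h.neg m hneg
  have h1 := h.half_le
  have h2 := h.mul_le_one
  constructor
  · intro hlt
    have hd : d m = 1 := by
      apply h.digit_of_neg hneg <;> rw [ht, neg_neg] <;> push_cast
      · nlinarith [one_le_lam h.three_le]
      · linarith
    rw [hd, ht, neg_neg] at e
    push_cast at e
    have h3 := h.t_ne (m + 1)
    have h4 : t (m + 1) = A' := by rw [e.1]; linarith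
    exact ⟨h4, lt_of_le_of_ne (by rw [h4]; exact hA0) h3.symm⟩
  · intro hge hlt
    have hd : d m = 2 := by
      apply h.digit_of_neg hneg <;> rw [ht, neg_neg] <;> push_cast
      · linarith
      · nlinarith
    rw [hd, ht, neg_neg] at e
    push_cast at e
    exact ⟨by rw [e.1]; linarith, e.2⟩

/-! ### Even indices -/

lemma neg_of_widthsBelow_two (h : RosenOrbit q α t v d) (hv : UnitBounded v) {N n : ℕ}
    (hb : WidthsBelow t v 2 N) (hn : N < n) : t n < 0 := by
  obtain ⟨n, rfl⟩ : ∃ k, n = k + 1 := ⟨n - 1, by omega⟩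
  by_contra! hc
  have ht := lt_of_le_of_ne hc (h.t_ne _).symm
  have h1 := (h.t_add_inv_lt hb hv (by omega : N ≤ n) ht).1
  have h2 : t (n + 1) * (1 / t (n + 1)) = 1 := by rw [mul_one_div, div_self ht.ne']
  have : 0 < 1 / t (n + 1) := by positivity
  nlinarith [sq_nonneg (t (n + 1) - 1 / t (n + 1))]

/-- For q = 4 this is A < λ. Otherwise, if λA ≥ 2, leaving the run one step early gives A' < λ - 1 <
λ / 2 ≤ αλ, hence a positive tail, which is impossible. -/
lemma even_window {r : ℕ} (h : RosenOrbit (2 * (r + 2)) α t v d) (hv : UnitBounded v) {N n : ℕ}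
    (hb : WidthsBelow t v 2 N) (hn : N < n) (htn : t n < 0)
    (hvn : v n ≤ 1 / (lam (2 * (r + 2)) + (lam (2 * (r + 2)) - 1))) :
    lam (2 * (r + 2)) * (lam (2 * (r + 2)) + t n) < 2 := by
  have hq := h.three_le
  have hst := h.start_bound hv hb hn hvn
  have hl1 := one_le_lam hq
  have hl2 := lam_lt_two hq
  have hl := h.lam_pos
  have hneg := fun k => h.neg_of_widthsBelow_two hv hb (n := k)
  have hrun := fun i hi hA => (h.run (A := lam (2 * (r + 2)) + t n) (by ring) (n := n) i hi hA).1
  have hexit := fun {m s A'} => h.run_exit (m := m) (s := s) (A' := A')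
  have e1 := sn_add_two (2 * (r + 2)) r
  have e2 := sn_add_two (2 * (r + 2)) (r + 1)
  have e3 := sn_symm hq (show r + 3 + (r + 1) = 2 * (r + 2) by ring)
  have p2 := sn_pos hq (show 0 < r + 2 by omega) (by omega)
  have hhalf := h.neg_half_le
  have hα := h.half_le
  by_contra! hc
  rcases r with _ | r
  · have := lam_four_sq
    norm_num at *
    nlinarith
  have l6 := three_le_lam_sq (q := 2 * (r + 1 + 2)) (by omega)
  have e0 := sn_add_two (2 * (r + 1 + 2)) r
  rw [show r + 1 + 1 = r + 2 by ring, show r + 1 + 2 = r + 3 by ring,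
    show r + 1 + 3 = r + 4 by ring] at *
  rw [show r + 2 + 2 = r + 4 by ring, show r + 2 + 1 = r + 3 by ring] at *
  set l := lam (2 * (r + 3)) with hldef
  set S := sn (2 * (r + 3)) with hS
  set A := l + t n with hAdef
  have f2 : S (r + 2) = l / 2 * S (r + 3) := by linarith
  have f1 : S (r + 1) = (l ^ 2 / 2 - 1) * S (r + 3) := by
    rw [f2] at e1; linarith
  have hA3 : A < 3 - l := by linarith
  have hAw : (l ^ 2 - 2) * A < l := by
    have : (l ^ 2 - 2) * A ≤ (l ^ 2 - 2) * (3 - l) := by gcongr; linarith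
    have : (3 - l) * (l ^ 2 - 2) < l := by
      nlinarith [mul_pos (show 0 < 2 - l by linarith) (show 0 < l by linarith)]
    linarith
  have hA : S (r + 1) * A < S (r + 2) := by
    rw [f1, f2]; nlinarith
  have h1 := hrun r (by omega) hA
  have h2 := cornerT_pos hq (show r + 2 ≤ _ by omega) hA
  have h3 : 1 / cornerT (2 * (r + 3)) A r - l = (l * A - 2) / (l - (l ^ 2 - 2) * A) := by
    rw [inv_cornerT_sub hA, ← hS, f1, f2, div_eq_div_iff (by nlinarith) (by linarith)]
    ring
  have h4 : (l * A - 2) / (l - (l ^ 2 - 2) * A) < l - 1 := by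
    rw [div_lt_iff₀ (by linarith)]
    -- After clearing denominators the inequality is linear in A. At the extreme value A = 3 - λ the
    -- two sides differ by (2 - λ)² (λ - 1)(λ + 1).
    have hc1 : (l * (3 - l) - 2) ≤ (l - 1) * (l - (l ^ 2 - 2) * (3 - l)) := by
      nlinarith [mul_nonneg (sq_nonneg (2 - l)) (mul_nonneg (show 0 ≤ l - 1 by linarith)
        (show 0 ≤ l + 1 by linarith))]
    have hc2 : 0 < l + (l - 1) * (l ^ 2 - 2) := by
      have : 0 ≤ (l - 1) * (l ^ 2 - 2) := mul_nonneg (by linarith) (by linarith)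
      linarith
    nlinarith [mul_pos hc2 (show 0 < 3 - l - A by linarith)]
  have h5 := (hexit h2 h1 h3 (div_nonneg (by linarith) (by linarith))).1 (by nlinarith)
  linarith [hneg (n + r + 1) (by omega)]

end RosenOrbit

end AlphaRosen

/-! ### Even indices: the staircase and the expanding map. -/

namespace AlphaRosen

namespace RosenOrbit

variable {α : ℝ} {t v : ℕ → ℝ} {d : ℕ → ℤ}

lemma even_sn_rel (r : ℕ) :
    sn (2 * (r + 2)) (r + 1) = lam (2 * (r + 2)) / 2 * sn (2 * (r + 2)) (r + 2) ∧
    sn (2 * (r + 2)) r = (lam (2 * (r + 2)) ^ 2 / 2 - 1) * sn (2 * (r + 2)) (r + 2) := by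
  have hq : 3 ≤ 2 * (r + 2) := by omega
  have e1 := sn_add_two (2 * (r + 2)) r
  have e2 := sn_add_two (2 * (r + 2)) (r + 1)
  have e3 := sn_symm hq (show r + 1 + 2 + (r + 1) = 2 * (r + 2) by ring)
  rw [show r + 1 + 1 = r + 2 by ring] at e2
  have f2 : sn (2 * (r + 2)) (r + 1) = lam (2 * (r + 2)) / 2 * sn (2 * (r + 2)) (r + 2) := by
    linarith
  refine ⟨f2, ?_⟩
  rw [f2] at e1
  linarith

lemma even_chain (r : ℕ) : CornerChain (lam (2 * (r + 2))) 1 1 1 1 r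
    (cornerT (2 * (r + 2)) 1) (cornerV (2 * (r + 2)) 1) := by
  have hq : 3 ≤ 2 * (r + 2) := by omega
  have p2 := sn_pos hq (show 0 < r + 2 by omega) (by omega)
  obtain ⟨f1, f0⟩ := even_sn_rel r
  have hl1 := one_le_lam hq
  have hl2 := lam_lt_two hq
  apply cornerChain_corner hq (by omega) zero_le_one
  · rw [f1]; nlinarith
  · have h : 0 < (2 - lam (2 * (r + 2))) * (1 + lam (2 * (r + 2))) :=
      mul_pos (by linarith) (by linarith)
    rw [cornerT, f1, f0, div_eq_div_iff (by nlinarith) (by linarith)]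
    ring
  · rw [cornerV, f1, f0, div_eq_iff (by nlinarith)]
    ring

lemma even_staircase {r : ℕ} (h : RosenOrbit (2 * (r + 2)) α t v d) (n : ℕ) :
    (0 ≤ v n ∧ v n ≤ 1 ∧ 0 < v (n + 1)) ∧
      (t n ≤ -(lam (2 * (r + 2)) - 1) → v n ≤ 1 / (lam (2 * (r + 2)) + 1)) := by
  have hc := even_chain r
  have hl1 := one_le_lam h.three_le
  have hl2 := lam_lt_two h.three_le
  -- For q even the two chains of `staircase` coincide, with R = 1.
  have hc1 : CornerChain (lam (2 * (r + 2))) 1 (1 / 1) (1 / 1) 1 r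
    (cornerT (2 * (r + 2)) 1) (cornerV (2 * (r + 2)) 1) := by simpa using hc
  have hc2 : CornerChain (lam (2 * (r + 2))) (1 / 1) 1 1 (1 / 1) r
    (cornerT (2 * (r + 2)) 1) (cornerV (2 * (r + 2)) 1) := by simpa using hc
  obtain ⟨h1, h2, -⟩ := h.staircase le_rfl h.mul_le_one (by linarith) (by linarith)
    (by linarith) hc1 hc2 n
  refine ⟨h1, fun ht => ?_⟩
  have := h2 0 (Nat.zero_le _) (by rwa [hc.σ_zero])
  rwa [hc.τ_zero] at this

/-- The run is left after `r` steps with (-1 : 2), so A becomes A' = (2A - λ) / (2 - λA). This map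
fixes 1 and A' - 1 = (2 + λ) / (2 - λA) · (A - 1). -/
lemma even_step {r : ℕ} (h : RosenOrbit (2 * (r + 2)) α t v d) (hv : UnitBounded v) {N n : ℕ}
    (hb : WidthsBelow t v 2 N) (hn : N < n) (htn : t n < 0)
    (hvn : v n ≤ 1 / (lam (2 * (r + 2)) + (lam (2 * (r + 2)) - 1))) :
    ∃ m, (N < m ∧ t m < 0 ∧ v m ≤ 1 / (lam (2 * (r + 2)) + (lam (2 * (r + 2)) - 1))) ∧
      2 * |lam (2 * (r + 2)) + t n - 1| ≤ |lam (2 * (r + 2)) + t m - 1| := by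
  have hq := h.three_le
  have hw := h.even_window hv hb hn htn hvn
  have hl1 := one_le_lam hq
  have hl2 := lam_lt_two hq
  have hlsq := two_le_lam_sq (q := 2 * (r + 2)) (by omega)
  have hneg := fun k => h.neg_of_widthsBelow_two hv hb (n := k)
  have hhalf := h.neg_half_le n
  have p2 := sn_pos hq (show 0 < r + 2 by omega) (by omega)
  obtain ⟨f1, f0⟩ := even_sn_rel r
  have h0 : sn (2 * (r + 2)) (r + 3) = sn (2 * (r + 2)) (r + 1) := sn_symm hq (by ring)
  have hA : sn (2 * (r + 2)) (r + 1) * (lam (2 * (r + 2)) + t n) < sn (2 * (r + 2)) (r + 2) := by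
    rw [f1]; nlinarith
  have h1 := (h.run (A := lam (2 * (r + 2)) + t n) (n := n) (by ring) r (by omega) hA).1
  have h2 := cornerT_pos hq (show r + 2 ≤ _ by omega) hA
  have h3 := inv_cornerT_sub hA
  rw [h0, f1] at h3
  set l := lam (2 * (r + 2)) with hldef
  set A := l + t n with hAdef
  have h4 : 1 / cornerT (2 * (r + 2)) A r - l = (2 * A - l) / (2 - l * A) := by
    rw [h3, div_eq_div_iff (by nlinarith) (by linarith)]
    ring
  have hA0 : 0 ≤ (2 * A - l) / (2 - l * A) := div_nonneg (by linarith) (by linarith)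
  have hex := h.run_exit h2 h1 h4 hA0
  set A' := (2 * A - l) / (2 - l * A) with hA'def
  have hge : α * l ≤ A' := by
    by_contra! hc
    linarith [hneg (n + r + 1) (by omega), (hex.1 hc).2]
  have hbad := (hb (n + r) (by omega)).2 (hneg _ (by omega))
  rw [h1, neg_neg] at hbad
  -- The width at the exit is λ + A' - v < 2. For q = 4 the bound v ≤ 1 is too weak; there the exit
  -- is the start itself, whose better bound on v applies.
  have hlt : A' < l := by
    rcases r with _ | r
    · have h5 : 1 / (l + (l - 1)) ≤ 0.6 := by
        rw [div_le_iff₀ (by linarith)]; nlinarith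
      rw [add_zero] at hbad
      nlinarith
    · have h6 := three_le_lam_sq (q := 2 * (r + 1 + 2)) (by omega)
      have := (hv (n + (r + 1))).2.1
      nlinarith
  obtain ⟨h7, h8⟩ := hex.2 hge hlt
  refine ⟨n + r + 1, ⟨by omega, hneg _ (by omega), ?_⟩, ?_⟩
  · rw [h8]
    have := (hv (n + r)).2.1
    exact one_div_le_one_div_of_le (by linarith) (by linarith)
  · have e : l + t (n + r + 1) - 1 = (2 + l) / (2 - l * A) * (A - 1) := by
      rw [h7, hA'def]
      field_simp [show 2 - l * A ≠ 0 by linarith]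
      ring
    rw [e, abs_mul]
    have h9 : 2 ≤ |(2 + l) / (2 - l * A)| := by
      refine le_trans ?_ (le_abs_self _)
      rw [le_div_iff₀ (by linarith)]
      nlinarith
    exact mul_le_mul_of_nonneg_right h9 (abs_nonneg _)

theorem not_widthsBelow_even {r : ℕ} (h : RosenOrbit (2 * (r + 2)) α t v d) (N : ℕ) :
    ¬ WidthsBelow t v 2 N := by
  intro hb
  have hv : UnitBounded v := fun n => (h.even_staircase n).1
  have hl1 := one_le_lam h.three_le
  obtain ⟨n, hn, h1, h2⟩ := h.exists_start_of_neg hv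
    (fun n hn => h.neg_of_widthsBelow_two hv hb (show N < n from hn))
  have h0 := eq_zero_of_expanding (P := fun m => N < m ∧ t m < 0 ∧
      v m ≤ 1 / (lam (2 * (r + 2)) + (lam (2 * (r + 2)) - 1)))
    (D := fun m => lam (2 * (r + 2)) + t m - 1) (c := 2) (K := 3) (by norm_num)
    (fun m hm => by
      have := h.neg_half_le m
      have := lam_lt_two h.three_le
      rw [abs_le]
      constructor <;> linarith [hm.2.1])
    (fun m hm => h.even_step hv hb hm.1 hm.2.1 hm.2.2) n ⟨by omega, h1, h2⟩
  -- At A = 1 the staircase makes the width at least (λ + 1) - (λ - 1) = 2.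
  have h3 := (h.even_staircase n).2 (by linarith)
  obtain ⟨n, rfl⟩ : ∃ k, n = k + 1 := ⟨n - 1, by omega⟩
  have h4 := h.inv_v_add_t_lt hb (by omega : N ≤ n)
  have h5 := one_div_le_one_div_of_le (hv n).2.2 h3
  rw [one_div_one_div] at h5
  linarith

end RosenOrbit

end AlphaRosen

namespace AlphaRosen

/-! ### The golden ratio of an odd index -/

/-- `R` is the positive root of `X² + (2 - l) X - 1`. -/
structure IsOddRoot (l R : ℝ) : Prop where
  pos : 0 < R
  root : R ^ 2 + (2 - l) * R = 1

namespace IsOddRoot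

variable {l R : ℝ}

lemma inv_eq (hR : IsOddRoot l R) : 1 / R = R + 2 - l := by
  rw [div_eq_iff hR.pos.ne']
  linarith [hR.root]

lemma lt_one (hR : IsOddRoot l R) (hl : l < 2) : R < 1 := by
  nlinarith [hR.root, hR.pos]

lemma half_lt (hR : IsOddRoot l R) (hl : l < 2) : l / 2 < R := by
  nlinarith [hR.root, hR.pos, sq_pos_of_pos (show 0 < 2 - l by linarith)]

lemma one_lt_inv (hR : IsOddRoot l R) (hl : l < 2) : 1 < 1 / R := by
  rw [lt_div_iff₀ hR.pos]
  linarith [hR.lt_one hl]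

lemma lt_of_add_inv_lt (hR : IsOddRoot l R) (hl : l < 2) {x : ℝ} (hx : 0 < x)
    (hxx : x + 1 / x < R + 1 / R) : R < x := by
  by_contra! hc
  have e0 := hR.one_lt_inv hl
  have e1 : x * (1 / x) = 1 := by rw [mul_one_div, div_self hx.ne']
  have e2 : R * (1 / R) = 1 := by rw [mul_one_div, div_self hR.pos.ne']
  have e3 : 0 ≤ (R - x) * (1 / R - x) :=
    mul_nonneg (by linarith) (by linarith [hR.lt_one hl])
  have e4 : x * (x + 1 / x) < x * (R + 1 / R) := by gcongr
  nlinarith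

/-- The lower bound `B ≥ l - 1` forces `A < 1 / (l - 1)`. -/
lemma mul_lt_one (hR : IsOddRoot l R) (hl1 : 1 < l) (hl : l < 2) {A : ℝ}
    (hA : A + (l - 1) < R + 1 / R) : A * (l - 1) < 1 := by
  by_contra! hc
  have h1 := hR.half_lt hl
  have h2 := hR.one_lt_inv hl
  have h3 : R * (1 / R) = 1 := by rw [mul_one_div, div_self hR.pos.ne']
  have h4 : 0 < (R - (l - 1)) * (1 / R - (l - 1)) := mul_pos (by linarith) (by linarith)
  nlinarith

/-- The left side is √(4 + (2 - λ)²) ≤ 2 + (2 - λ)² / 4. The right side is what the exit width would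
exceed in `odd_step_short` if A' ≥ 1. -/
lemma sum_le (hR : IsOddRoot l R) (hl1 : 8 / 5 ≤ l) (hl : l < 2) :
    R + 1 / R ≤ 1 + l / (l ^ 2 - 2 * l + 2) := by
  have h0 : 0 < l ^ 2 - 2 * l + 2 := by nlinarith [sq_nonneg (l - 1)]
  have h1 : R + 1 / R ≤ 2 + (2 - l) ^ 2 / 4 := by
    have h2 : (R + 1 / R) ^ 2 = 4 + (2 - l) ^ 2 := by
      rw [hR.inv_eq]; nlinarith [hR.root]
    have h3 : 0 < 1 / R := one_div_pos.mpr hR.pos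
    refine abs_le_of_sq_le_sq' ?_ (by positivity) |>.2
    rw [h2]
    nlinarith [sq_nonneg ((2 - l) ^ 2)]
  have h2 : 1 + (2 - l) ^ 2 / 4 ≤ l / (l ^ 2 - 2 * l + 2) := by
    rw [le_div_iff₀ h0]
    obtain ⟨e, rfl⟩ : ∃ e, l = 2 - e := ⟨2 - l, by ring⟩
    have he : 0 < e := by linarith
    have he' : e ≤ 2 / 5 := by linarith
    have : 0 ≤ e * (1 - 3 / 2 * e - e ^ 3 / 4) := mul_nonneg he.le (by nlinarith [sq_nonneg e])
    nlinarith [pow_pos he 3]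
  linarith

end IsOddRoot

/-! ### Corner chains for odd indices. -/

lemma odd_sn_rel (r : ℕ) :
    sn (2 * r + 5) (r + 3) = sn (2 * r + 5) (r + 2) ∧
    sn (2 * r + 5) (r + 4) = sn (2 * r + 5) (r + 1) ∧
    sn (2 * r + 5) (r + 1) = (lam (2 * r + 5) - 1) * sn (2 * r + 5) (r + 2) ∧
    sn (2 * r + 5) r =
      (lam (2 * r + 5) ^ 2 - lam (2 * r + 5) - 1) * sn (2 * r + 5) (r + 2) := by
  have hq : 3 ≤ 2 * r + 5 := by omega
  have e1 := sn_add_two (2 * r + 5) r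
  have e2 := sn_add_two (2 * r + 5) (r + 1)
  have e3 := sn_symm hq (show r + 3 + (r + 2) = 2 * r + 5 by ring)
  have e4 := sn_symm hq (show r + 4 + (r + 1) = 2 * r + 5 by ring)
  rw [show r + 1 + 2 = r + 3 by ring, show r + 1 + 1 = r + 2 by ring] at e2
  have f1 : sn (2 * r + 5) (r + 1) = (lam (2 * r + 5) - 1) * sn (2 * r + 5) (r + 2) := by
    linarith
  refine ⟨e3, e4, f1, ?_⟩
  rw [f1] at e1
  linarith

lemma odd_lam_bounds (r : ℕ) : 0 ≤ lam (2 * r + 5) ^ 2 - lam (2 * r + 5) - 1 ∧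
    8 / 5 ≤ lam (2 * r + 5) ∧ lam (2 * r + 5) < 2 := by
  have h := golden_lam (q := 2 * r + 5) (by omega)
  have h1 := one_le_lam (q := 2 * r + 5) (by omega)
  exact ⟨h, by nlinarith, lam_lt_two (by omega)⟩

lemma odd_chain_unit (r : ℕ) : CornerChain (lam (2 * r + 5)) (2 / lam (2 * r + 5)) 0 1 1 r
    (cornerT (2 * r + 5) (2 / lam (2 * r + 5))) (cornerV (2 * r + 5) 0) := by
  have hq : 3 ≤ 2 * r + 5 := by omega
  have p2 := sn_pos hq (show 0 < r + 2 by omega) (by omega)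
  obtain ⟨-, -, f1, f0⟩ := odd_sn_rel r
  obtain ⟨h1, h2, h3⟩ := odd_lam_bounds r
  set l := lam (2 * r + 5)
  have hl : l ≠ 0 := by linarith
  have hi : l * (2 / l) = 2 := by field_simp
  have hlt : (l - 1) * (2 / l) < 1 := by
    rw [mul_div_assoc', div_lt_one (by linarith)]; linarith
  apply cornerChain_corner hq (by omega) le_rfl
  · rw [f1]; nlinarith
  · have h : 0 < l - 1 - (l ^ 2 - l - 1) * (2 / l) := by nlinarith
    rw [cornerT, f1, f0, div_eq_div_iff (by nlinarith) (by linarith)]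
    linear_combination (sn (2 * r + 5) (r + 2)) * (-1) * hi
  · rw [cornerV, f1, f0, div_eq_iff (by nlinarith)]
    ring

/-- The extremal orbit alternates between two runs: one of `r + 1` steps exchanges the end
parameters R and 1 / R, and one of `r` steps (`odd_chain_short`) exchanges them back. -/
lemma odd_chain_long (r : ℕ) {R : ℝ} (hR : IsOddRoot (lam (2 * r + 5)) R) :
    CornerChain (lam (2 * r + 5)) R (1 / R) (1 / R) R (r + 1)
    (cornerT (2 * r + 5) R) (cornerV (2 * r + 5) (1 / R)) := by
  have hq : 3 ≤ 2 * r + 5 := by omega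
  have p2 := sn_pos hq (show 0 < r + 2 by omega) (by omega)
  obtain ⟨f3, -, f1, f0⟩ := odd_sn_rel r
  obtain ⟨h1, h2, h3⟩ := odd_lam_bounds r
  have hR0 := hR.pos
  have hR1 := hR.lt_one h3
  have hRr := hR.root
  have hRi := hR.one_lt_inv h3
  have hden : 0 < sn (2 * r + 5) (r + 2) * (1 - (lam (2 * r + 5) - 1) * R) :=
    mul_pos p2 (by nlinarith)
  apply cornerChain_corner hq (by omega) (by linarith)
  · rw [show r + 1 + 1 = r + 2 by ring, show r + 1 + 2 = r + 3 by ring, f3]; nlinarith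
  · rw [cornerT, show r + 1 + 1 = r + 2 by ring, show r + 1 + 2 = r + 3 by ring, f3, f1,
      div_eq_div_iff (by linarith) (by linarith), hR.inv_eq]
    linear_combination (-sn (2 * r + 5) (r + 2)) * hRr
  · rw [cornerV, show r + 1 + 1 = r + 2 by ring, show r + 1 + 2 = r + 3 by ring, f3, f1,
      div_eq_iff (by nlinarith), hR.inv_eq]
    linear_combination (sn (2 * r + 5) (r + 2)) * hRr

lemma odd_chain_short (r : ℕ) {R : ℝ} (hR : IsOddRoot (lam (2 * r + 5)) R) :
    CornerChain (lam (2 * r + 5)) (1 / R) R R (1 / R) r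
    (cornerT (2 * r + 5) (1 / R)) (cornerV (2 * r + 5) R) := by
  have hq : 3 ≤ 2 * r + 5 := by omega
  have p2 := sn_pos hq (show 0 < r + 2 by omega) (by omega)
  obtain ⟨f3, -, f1, f0⟩ := odd_sn_rel r
  obtain ⟨h1, h2, h3⟩ := odd_lam_bounds r
  have hR0 := hR.pos
  have hRr := hR.root
  have hRi := hR.one_lt_inv h3
  have hRh := hR.half_lt h3
  set l := lam (2 * r + 5)
  have hRm : R * (1 / R) = 1 := by rw [mul_one_div, div_self hR.pos.ne']
  have hlt : (l - 1) * (1 / R) < 1 := by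
    rw [mul_one_div, div_lt_one hR0]; linarith
  have hA : sn (2 * r + 5) (r + 1) * (1 / R) < sn (2 * r + 5) (r + 2) := by
    rw [f1]; nlinarith
  apply cornerChain_corner hq (by omega) hR0.le hA
  · have := cornerT_den_pos hq (show r + 2 ≤ 2 * r + 5 by omega) hA
    rw [cornerT, div_eq_div_iff this.ne' (by linarith), f1, f0, hR.inv_eq]
    linear_combination (1 - l) * (sn (2 * r + 5) (r + 2)) * hRr
  · rw [cornerV, div_eq_iff (cornerV_den_pos hq hR0.le (by omega)).ne', f1, f0, hR.inv_eq]
    linear_combination (l - 1) * (sn (2 * r + 5) (r + 2)) * hRr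

end AlphaRosen

namespace AlphaRosen

namespace RosenOrbit

variable {α : ℝ} {t v : ℕ → ℝ} {d : ℕ → ℤ} {r : ℕ} {R : ℝ}

/-! ### Odd indices `q ≥ 5` -/

/-- A run starts after the index `N`. -/
def IsStart (l : ℝ) (t v : ℕ → ℝ) (N n : ℕ) : Prop :=
  N < n ∧ t n < 0 ∧ v n ≤ 1 / (l + (l - 1))

lemma odd_unitBounded (h : RosenOrbit (2 * r + 5) α t v d) : UnitBounded v :=
  h.unitBounded_of_chain (odd_chain_unit r)

/-- A positive tail is larger than `R`, and is followed by a start. -/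
lemma odd_flip (h : RosenOrbit (2 * r + 5) α t v d) (hR : IsOddRoot (lam (2 * r + 5)) R) {N n : ℕ}
    (hb : WidthsBelow t v (R + 1 / R) N) (hn : N < n) (ht : 0 < t n) :
    R < t n ∧ IsStart (lam (2 * r + 5)) t v N (n + 1) ∧
      t (n + 1) = -(lam (2 * r + 5) - 1 / t n) := by
  have hv := h.odd_unitBounded
  obtain ⟨h1, h2, h3⟩ := odd_lam_bounds r
  have hRh := hR.half_lt h3
  have hR1 := hR.lt_one h3
  have hRi := hR.one_lt_inv h3
  have hRe := hR.inv_eq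
  have hR0 := hR.pos
  obtain ⟨n, rfl⟩ : ∃ k, n = k + 1 := ⟨n - 1, by omega⟩
  obtain ⟨ha, hb'⟩ := h.t_add_inv_lt hb hv (by omega : N ≤ n) ht
  have hRt := hR.lt_of_add_inv_lt h3 ht ha
  have hRv := hR.lt_of_add_inv_lt h3 (hv n).2.2 hb'
  have hti : 1 / t (n + 1) < 1 / R := one_div_lt_one_div_of_lt hR0 hRt
  have hti1 : 1 < 1 / t (n + 1) := by
    rw [lt_div_iff₀ ht]; linarith [h.t_lt_one (n + 1)]
  have hα := h.half_le
  have hαl := h.mul_le_one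
  have hd : d (n + 1) = 1 := by
    apply h.digit_of_pos ht <;> push_cast <;> nlinarith
  have e := h.pos (n + 1) ht
  rw [hd] at e
  push_cast at e
  rw [one_mul] at e
  refine ⟨hRt, ⟨by omega, by rw [e.1]; linarith, ?_⟩, by rw [e.1]; ring⟩
  rw [e.2]
  exact one_div_le_one_div_of_le (by linarith) (by linarith)

lemma odd_window (h : RosenOrbit (2 * r + 5) α t v d) (hR : IsOddRoot (lam (2 * r + 5)) R)
    {N n : ℕ} (hb : WidthsBelow t v (R + 1 / R) N) (hn : IsStart (lam (2 * r + 5)) t v N n) :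
    (lam (2 * r + 5) + t n) * (lam (2 * r + 5) - 1) < 1 := by
  obtain ⟨h1, h2, h3⟩ := odd_lam_bounds r
  exact hR.mul_lt_one (by linarith) h3 (h.start_bound h.odd_unitBounded hb hn.1 hn.2.2)

/-- The end of a run which is left with the digit `(-1 : 2)`. -/
lemma odd_turn (h : RosenOrbit (2 * r + 5) α t v d) (hR : IsOddRoot (lam (2 * r + 5)) R)
    {N m : ℕ} (hb : WidthsBelow t v (R + 1 / R) N) (hm : N < m) {s A' : ℝ} (hs : 0 < s)
    (ht : t m = -s) (hA : 1 / s - lam (2 * r + 5) = A')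
    (hge : α * lam (2 * r + 5) ≤ A') :
    IsStart (lam (2 * r + 5)) t v N (m + 1) ∧ lam (2 * r + 5) + t (m + 1) = A' ∧
      lam (2 * r + 5) + A' - v m < R + 1 / R := by
  obtain ⟨h1, h2, h3⟩ := odd_lam_bounds r
  have hv := (h.odd_unitBounded m).2.1
  have hbad := (hb m hm.le).2 (by linarith)
  rw [ht, neg_neg] at hbad
  have hα := h.half_le
  have hw := hR.mul_lt_one (by linarith) h3 (show A' + (lam (2 * r + 5) - 1) < _ by linarith)
  have hlt : A' < lam (2 * r + 5) := by
    by_contra! hc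
    nlinarith
  obtain ⟨e1, e2⟩ := (h.run_exit hs ht hA (by nlinarith)).2 hge hlt
  refine ⟨⟨by omega, by linarith, ?_⟩, by rw [e1]; ring, by linarith⟩
  rw [e2]
  exact one_div_le_one_div_of_le (by linarith) (by linarith)

/-- A run with A ≥ 1 is followed for `r` steps. If A' < αλ, the next tail is positive and equals A',
and `odd_flip` turns it into a start with parameter 1 / A'. Otherwise the digit (-1 : 2) gives a
start with parameter A' itself. -/
lemma odd_step_short (h : RosenOrbit (2 * r + 5) α t v d) (hR : IsOddRoot (lam (2 * r + 5)) R)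
    {N n : ℕ} {A : ℝ} (hb : WidthsBelow t v (R + 1 / R) N)
    (hn : IsStart (lam (2 * r + 5)) t v N n) (hA : A = lam (2 * r + 5) + t n) (h1A : 1 ≤ A) :
    0 < 1 - (lam (2 * r + 5) - 1) * A ∧
    ∃ A', A' = (A - 1) / (1 - (lam (2 * r + 5) - 1) * A) ∧
      ((R < A' ∧ A' < 1 ∧
          ∃ m, IsStart (lam (2 * r + 5)) t v N m ∧ lam (2 * r + 5) + t m = 1 / A') ∨
        (α * lam (2 * r + 5) ≤ A' ∧ A' < 1 ∧
          ∃ m, IsStart (lam (2 * r + 5)) t v N m ∧ lam (2 * r + 5) + t m = A')) := by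
  have hq := h.three_le
  have hw := h.odd_window hR hb hn
  rw [← hA] at hw
  obtain ⟨h1, h2, h3⟩ := odd_lam_bounds r
  obtain ⟨f3, f4, f1, f0⟩ := odd_sn_rel r
  have p2 := sn_pos hq (show 0 < r + 2 by omega) (by omega)
  have hpos : 0 < 1 - (lam (2 * r + 5) - 1) * A := by linarith
  refine ⟨hpos, _, rfl, ?_⟩
  have hA1 : sn (2 * r + 5) (r + 1) * A < sn (2 * r + 5) (r + 2) := by
    rw [f1]; nlinarith
  have htn : t n = -(lam (2 * r + 5) - A) := by rw [hA]; ring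
  have e1 := (h.run htn r (by omega) hA1).1
  have e2 := cornerT_pos hq (show r + 2 ≤ 2 * r + 5 by omega) hA1
  have e3 := inv_cornerT_sub hA1
  rw [f3, f1] at e3
  have e4 : 1 / cornerT (2 * r + 5) A r - lam (2 * r + 5) =
      (A - 1) / (1 - (lam (2 * r + 5) - 1) * A) := by
    rw [e3, div_eq_div_iff (by nlinarith) hpos.ne']
    ring
  have hA0 : 0 ≤ (A - 1) / (1 - (lam (2 * r + 5) - 1) * A) := div_nonneg (by linarith) hpos.le
  set A' := (A - 1) / (1 - (lam (2 * r + 5) - 1) * A)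
  rcases lt_or_ge A' (α * lam (2 * r + 5)) with hlt | hge
  · left
    obtain ⟨e5, e6⟩ := (h.run_exit e2 e1 e4 hA0).1 hlt
    obtain ⟨e7, e8, e9⟩ := h.odd_flip hR hb (by have := hn.1; omega) e6
    rw [e5] at e7 e9
    exact ⟨e7, hlt.trans_le h.mul_le_one, n + r + 1 + 1, e8, by rw [e9]; ring⟩
  · right
    obtain ⟨e5, e6, e7⟩ := h.odd_turn hR hb (by have := hn.1; omega) e2 e1 e4 hge
    refine ⟨hge, ?_, n + r + 1, e5, e6⟩
    by_contra! hc
    -- Carrying the initial bound B ≥ λ - 1 along the corners bounds v at the exit by λ - λ / (λ² -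
    -- 2λ + 2). With A' ≥ 1 the exit width then violates `sum_le`.
    have e8 := h.run_v_le htn (show 0 ≤ lam (2 * r + 5) - 1 by linarith) hn.2.2 r (by omega) hA1
    have e9 : cornerV (2 * r + 5) (lam (2 * r + 5) - 1) r =
        lam (2 * r + 5) -
          lam (2 * r + 5) / (lam (2 * r + 5) ^ 2 - 2 * lam (2 * r + 5) + 2) := by
      have h0 : 0 < lam (2 * r + 5) ^ 2 - 2 * lam (2 * r + 5) + 2 := by
        nlinarith [sq_nonneg (lam (2 * r + 5) - 1)]
      rw [cornerV, f1, f0, sub_div' h0.ne', div_eq_div_iff _ h0.ne']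
      · ring
      · have : 0 < sn (2 * r + 5) (r + 2) * (lam (2 * r + 5) ^ 2 - 2 * lam (2 * r + 5) + 2) :=
          mul_pos p2 h0
        nlinarith
    linarith [hR.sum_le h2 h3]

/-- A run with A < 1 lasts one step longer. From A ≥ λ / 2 the new parameter is at least 1 ≥ αλ, so
no positive tail arises. -/
lemma odd_step_long (h : RosenOrbit (2 * r + 5) α t v d) (hR : IsOddRoot (lam (2 * r + 5)) R)
    {N n : ℕ} {A : ℝ} (hb : WidthsBelow t v (R + 1 / R) N)
    (hn : IsStart (lam (2 * r + 5)) t v N n) (hA : A = lam (2 * r + 5) + t n) (hA1 : A < 1) :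
    ∃ m, IsStart (lam (2 * r + 5)) t v N m ∧
      lam (2 * r + 5) + t m = (A - (lam (2 * r + 5) - 1)) / (1 - A) ∧
      1 ≤ lam (2 * r + 5) + t m := by
  have hq := h.three_le
  obtain ⟨h1, h2, h3⟩ := odd_lam_bounds r
  obtain ⟨f3, f4, f1, f0⟩ := odd_sn_rel r
  have p2 := sn_pos hq (show 0 < r + 2 by omega) (by omega)
  have hhalf := h.neg_half_le n
  have hA2 : sn (2 * r + 5) (r + 1 + 1) * A < sn (2 * r + 5) (r + 1 + 2) := by
    rw [show r + 1 + 1 = r + 2 by ring, show r + 1 + 2 = r + 3 by ring, f3]; nlinarith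
  have htn : t n = -(lam (2 * r + 5) - A) := by rw [hA]; ring
  have e1 := (h.run htn (r + 1) (by omega) hA2).1
  have e2 := cornerT_pos hq (show r + 1 + 2 ≤ 2 * r + 5 by omega) hA2
  have e3 := inv_cornerT_sub hA2
  rw [show r + 1 + 1 = r + 2 by ring, show r + 1 + 2 = r + 3 by ring,
    show r + 1 + 3 = r + 4 by ring, f3, f4, f1] at e3
  have e4 : 1 / cornerT (2 * r + 5) A (r + 1) - lam (2 * r + 5) =
      (A - (lam (2 * r + 5) - 1)) / (1 - A) := by
    rw [e3, div_eq_div_iff (by nlinarith) (by linarith)]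
    ring
  have hge : 1 ≤ (A - (lam (2 * r + 5) - 1)) / (1 - A) := by
    rw [le_div_iff₀ (by linarith)]; linarith
  obtain ⟨e5, e6, -⟩ := h.odd_turn hR hb (by have := hn.1; omega) e2 e1 e4
    (h.mul_le_one.trans hge)
  exact ⟨_, e5, e6, by rw [e6]; exact hge⟩

lemma odd_exists_start (h : RosenOrbit (2 * r + 5) α t v d) (hR : IsOddRoot (lam (2 * r + 5)) R)
    {N : ℕ} (hb : WidthsBelow t v (R + 1 / R) N) :
    ∃ n, IsStart (lam (2 * r + 5)) t v N n ∧ 1 ≤ lam (2 * r + 5) + t n := by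
  suffices ∃ n, IsStart (lam (2 * r + 5)) t v N n by
    obtain ⟨n, hn⟩ := this
    rcases le_or_gt 1 (lam (2 * r + 5) + t n) with h1 | h1
    · exact ⟨n, hn, h1⟩
    · obtain ⟨m, hm, -, hm'⟩ := h.odd_step_long hR hb hn rfl h1
      exact ⟨m, hm, hm'⟩
  have hp : ∀ n, N < n → 0 < t n → ∃ n, IsStart (lam (2 * r + 5)) t v N n :=
    fun n hn ht => ⟨_, (h.odd_flip hR hb hn ht).2.1⟩
  rcases (h.t_ne (N + 1)).lt_or_gt with ht | ht
  · obtain ⟨m, hm, h1, h2⟩ := h.exists_run_end ht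
    rcases (h.t_ne (m + 1)).lt_or_gt with ht' | ht'
    · exact ⟨m + 1, by omega, ht', h.after_run_end h.odd_unitBounded h1 h2 ht'⟩
    · exact hp (m + 1) (by omega) ht'
  · exact hp (N + 1) (by omega) ht

/-- The short step sends 1 / R to R with the stated expansion. Both continuations, x ↦ 1 / x and the
long step, send R back to 1 / R and do not decrease the distance. -/
lemma odd_expand (h : RosenOrbit (2 * r + 5) α t v d) (hR : IsOddRoot (lam (2 * r + 5)) R)
    {N n : ℕ} (hb : WidthsBelow t v (R + 1 / R) N)
    (hn : IsStart (lam (2 * r + 5)) t v N n) (h1A : 1 ≤ lam (2 * r + 5) + t n) :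
    ∃ m, (IsStart (lam (2 * r + 5)) t v N m ∧ 1 ≤ lam (2 * r + 5) + t m) ∧
      1 / (1 - (lam (2 * r + 5) - 1) * (1 / R)) * |lam (2 * r + 5) + t n - 1 / R| ≤
        |lam (2 * r + 5) + t m - 1 / R| := by
  obtain ⟨h1, h2, h3⟩ := odd_lam_bounds r
  have hRh := hR.half_lt h3
  have hR1 := hR.lt_one h3
  have hR0 := hR.pos
  have hRe := hR.inv_eq
  have hRr := hR.root
  obtain ⟨hpos, A', hA', hcase⟩ := h.odd_step_short hR hb hn rfl h1A
  have hhalf := h.neg_half_le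
  have hα := h.half_le
  set l := lam (2 * r + 5)
  set A := l + t n
  have hk : 0 < 1 - (l - 1) * (1 / R) := by
    rw [mul_one_div, sub_pos, div_lt_one hR0]; linarith
  have e1 : A' - R = (2 - l) / (1 - (l - 1) * A) *
      (1 / (1 - (l - 1) * (1 / R)) * (A - 1 / R)) := by
    have : R = (1 / R - 1) / (1 - (l - 1) * (1 / R)) := by
      rw [eq_div_iff hk.ne', hRe]; nlinarith
    rw [hA']
    nth_rewrite 1 [this]
    generalize 1 / R = x at hk ⊢
    rw [div_sub_div _ _ hpos.ne' hk.ne', one_div_mul_eq_div, div_mul_div_comm]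
    congr 1
    ring
  have e2 : 1 / (1 - (l - 1) * (1 / R)) * |A - 1 / R| ≤ |A' - R| := by
    rw [e1, abs_mul, abs_mul, abs_of_pos (one_div_pos.mpr hk)]
    refine le_mul_of_one_le_left (by positivity) ?_
    refine le_trans ?_ (le_abs_self _)
    rw [le_div_iff₀ hpos]
    nlinarith
  rcases hcase with ⟨h4, h5, m, hm, hm'⟩ | ⟨h4, h5, m, hm, hm'⟩
  · have hA0 : 0 < A' := by linarith
    refine ⟨m, ⟨hm, ?_⟩, e2.trans ?_⟩
    · rw [hm', le_div_iff₀ hA0]; linarith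
    · rw [hm']
      have : 1 / A' - 1 / R = -(1 / (A' * R)) * (A' - R) := by field_simp; ring
      rw [this, abs_mul, abs_neg]
      refine le_mul_of_one_le_left (abs_nonneg _) (le_trans ?_ (le_abs_self _))
      rw [le_div_iff₀ (by positivity)]
      nlinarith
  · obtain ⟨m', hm1, hm2, hm3⟩ := h.odd_step_long hR hb hm rfl (by rwa [hm'])
    refine ⟨m', ⟨hm1, hm3⟩, e2.trans ?_⟩
    have hA' : l / 2 ≤ A' := by rw [← hm']; linarith [hhalf m]
    have : l + t m' - 1 / R = (2 - l) / ((1 - A') * (1 - R)) * (A' - R) := by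
      have e3 : 1 / R = (R - (l - 1)) / (1 - R) := by
        rw [eq_div_iff (by linarith), hRe]; nlinarith
      rw [hm2, hm', e3]
      field_simp [show 1 - A' ≠ 0 by linarith, show 1 - R ≠ 0 by linarith]
      ring
    rw [this, abs_mul]
    refine le_mul_of_one_le_left (abs_nonneg _) (le_trans ?_ (le_abs_self _))
    rw [le_div_iff₀ (mul_pos (by linarith) (by linarith))]
    nlinarith

theorem not_widthsBelow_odd (h : RosenOrbit (2 * r + 5) α t v d)
    (hR : IsOddRoot (lam (2 * r + 5)) R) (N : ℕ) : ¬ WidthsBelow t v (R + 1 / R) N := by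
  intro hb
  obtain ⟨h1, h2, h3⟩ := odd_lam_bounds r
  have hRh := hR.half_lt h3
  have hR1 := hR.lt_one h3
  have hR0 := hR.pos
  have hRe := hR.inv_eq
  have hRr := hR.root
  have hv := h.odd_unitBounded
  obtain ⟨n, hn, hnA⟩ := h.odd_exists_start hR hb
  have hk : 0 < 1 - (lam (2 * r + 5) - 1) * (1 / R) := by
    rw [mul_one_div, sub_pos, div_lt_one hR0]; linarith
  have hRi : 0 < 1 / R := one_div_pos.mpr hR0
  have h0 := eq_zero_of_expanding
    (P := fun m => IsStart (lam (2 * r + 5)) t v N m ∧ 1 ≤ lam (2 * r + 5) + t m)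
    (D := fun m => lam (2 * r + 5) + t m - 1 / R)
    (c := 1 / (1 - (lam (2 * r + 5) - 1) * (1 / R))) (K := 3)
    (by rw [lt_div_iff₀ hk]; nlinarith)
    (fun m hm => by
      have := hm.1.2.1
      have := hm.2
      rw [abs_le]
      constructor <;> linarith)
    (fun m hm => h.odd_expand hR hb hm.1 hm.2) n ⟨hn, hnA⟩
  rcases le_or_gt (α * lam (2 * r + 5)) R with hα | hα
  · have h4 := (h.staircase hR1.le hα hRh (by nlinarith) (by nlinarith)
      (odd_chain_long r hR) (odd_chain_short r hR) n).2.2 0 (Nat.zero_le _)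
      (by rw [(odd_chain_short r hR).σ_zero]; linarith)
    rw [(odd_chain_short r hR).τ_zero] at h4
    obtain ⟨n, rfl⟩ : ∃ k, n = k + 1 := ⟨n - 1, by have := hn.1; omega⟩
    have h5 := h.inv_v_add_t_lt hb (by have := hn.1; omega : N ≤ n)
    have h6 := one_div_le_one_div_of_le (hv n).2.2 h4
    rw [one_div_one_div] at h6
    linarith
  -- If αλ > R the staircase is unavailable, but A = 1 / R gives A' = R, while both continuations
  -- require A' > R.
  · obtain ⟨hpos, A', hA', hcase⟩ := h.odd_step_short hR hb hn rfl hnA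
    have hAR : A' = R := by
      rw [hA', div_eq_iff hpos.ne', show lam (2 * r + 5) + t n = 1 / R by linarith, hRe]
      nlinarith
    rcases hcase with ⟨h4, -⟩ | ⟨h4, -⟩ <;> linarith

end RosenOrbit

end AlphaRosen

namespace AlphaRosen

namespace RosenOrbit

variable {α : ℝ} {t v : ℕ → ℝ} {d : ℕ → ℤ} {R : ℝ}

/-! ### The index `q = 3` -/

/-- For λ = 1 the digit (-1 : 1) never occurs: it would give |t m| = 1 / (1 + t (m + 1)) > 1 / 2. -/
lemma unitBounded_three (h : RosenOrbit 3 α t v d) : UnitBounded v := by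
  have den : ∀ m, 0 ≤ v m → v m ≤ 1 → 0 < v (m + 1) ∧ v (m + 1) ≤ 1 := by
    intro m h0 h1
    suffices ∃ D, 1 ≤ D ∧ v (m + 1) = 1 / D by
      obtain ⟨D, hD, e⟩ := this
      rw [e]
      exact ⟨one_div_pos.mpr (by linarith), by rw [div_le_iff₀ (by linarith)]; linarith⟩
    have hl := lam_three
    rcases (h.t_ne m).lt_or_gt with ht | ht
    · refine ⟨_, ?_, (h.neg m ht).2⟩
      have hd : d m ≠ 1 := by
        intro hd
        obtain ⟨e0, e1⟩ := h.neg_t_eq ht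
        rw [hd, lam_three] at e0 e1
        push_cast at e0 e1
        have h3 := h.t_lt_one (m + 1)
        have h4 := one_div_lt_one_div_of_lt e0 (show 1 * 1 + t (m + 1) < 2 by linarith)
        have h5 := h.neg_half_le m
        rw [lam_three] at h5
        linarith
      have := h.d_mul_ge_two hd
      linarith
    · refine ⟨_, ?_, (h.pos m ht).2⟩
      have := h.d_mul_ge m
      linarith
  have key : ∀ n, 0 ≤ v n ∧ v n ≤ 1 := by
    intro n
    induction n with
    | zero => rw [h.v_zero]; exact ⟨le_rfl, zero_le_one⟩
    | succ n ih => exact ⟨(den n ih.1 ih.2).1.le, (den n ih.1 ih.2).2⟩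
  exact fun n => ⟨(key n).1, (key n).2, (den n (key n).1 (key n).2).1⟩

/-- A late positive tail exceeds R, so it has digit 1 and its successor lies strictly between 0 and
1 / R - 1 = R. That successor is again positive and would have to exceed R. -/
lemma three_neg (h : RosenOrbit 3 α t v d) (hR : IsOddRoot 1 R) {N n : ℕ}
    (hb : WidthsBelow t v (R + 1 / R) N) (hn : N < n) : t n < 0 := by
  have hv := h.unitBounded_three
  have hp : ∀ n, N < n → 0 < t n → R < t n := by
    intro n hn ht
    obtain ⟨n, rfl⟩ : ∃ k, n = k + 1 := ⟨n - 1, by omega⟩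
    exact hR.lt_of_add_inv_lt (by norm_num) ht (h.t_add_inv_lt hb hv (by omega : N ≤ n) ht).1
  have hRe := hR.inv_eq
  have hl := lam_three
  by_contra! hc
  have ht := lt_of_le_of_ne hc (h.t_ne n).symm
  have h1 := hp n hn ht
  have h2 := h.t_lt n
  have h3 := h.t_lt_one n
  have h4 := one_div_lt_one_div_of_lt hR.pos h1
  have h5 : 1 < 1 / t n := by rwa [lt_div_iff₀ ht, one_mul]
  have hα := h.half_le
  have hαl := h.mul_le_one
  rw [hl] at h2 hαl
  have hd : d n = 1 := by
    apply h.digit_of_pos ht <;> rw [hl] <;> push_cast <;> linarith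
  have e := (h.pos n ht).1
  rw [hd, hl] at e
  push_cast at e
  have h6 := hp (n + 1) (by omega) (by linarith)
  linarith

/-- The digit exceeds 2 because the next tail is negative and 1 / |t n| ≥ 2. It is less than 4 by
the width bound, v n ≤ 1 and t (n + 1) ≥ -1 / 2. -/
lemma three_step (h : RosenOrbit 3 α t v d) (hR : IsOddRoot 1 R) {N n : ℕ}
    (hb : WidthsBelow t v (R + 1 / R) N) (hn : N < n) : t (n + 1) = 1 / (-t n) - 3 := by
  have ht := h.three_neg hR hb hn
  have ht' := h.three_neg hR hb (show N < n + 1 by omega)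
  have e := (h.neg n ht).1
  have h1 := h.neg_half_le n
  have h1' := h.neg_half_le (n + 1)
  have h2 := (hb n hn.le).2 ht
  have h3 := (h.unitBounded_three n).2.1
  rw [lam_three] at e h1 h1'
  have h4 : 2 ≤ 1 / (-t n) := by
    rw [le_div_iff₀ (by linarith)]; linarith
  have hR1 : R < 3 / 4 := by nlinarith [hR.root, hR.pos]
  rw [hR.inv_eq] at h2
  have h5 : (2 : ℝ) < d n := by linarith
  have h6 : (d n : ℝ) < 4 := by linarith
  have h7 : 2 < d n := by exact_mod_cast h5
  have h8 : d n < 4 := by exact_mod_cast h6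
  have hd : d n = 3 := by omega
  rw [e, hd]
  norm_num

/-- Induction backwards along the fixed point. A predecessor with digit 1 or 2 would have absolute
value 1 / R or R, outside the interval when α ≤ R; with digit (-1 : 3) it is the fixed point again;
all other digits make v small. -/
lemma three_staircase (h : RosenOrbit 3 α t v d) (hR : IsOddRoot 1 R) (hα : α ≤ R) (n : ℕ)
    (hn : t n = -(1 - R)) : v n ≤ 1 - R := by
  have hR0 := hR.pos
  have hRr := hR.root
  have hR1 : R < 2 / 3 := by nlinarith
  have hR2 : 1 / 2 < R := by nlinarith
  have hl := lam_three
  have hinv : 1 / (2 + R) = 1 - R := by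
    rw [div_eq_iff (by linarith)]; nlinarith
  induction n with
  | zero => rw [h.v_zero]; linarith
  | succ n ih =>
    have hv := h.unitBounded_three n
    have hRi : 1 / R = 1 + R := by rw [hR.inv_eq]; ring
    have hRi' : 1 / (1 + R) = R := by rw [← hRi, one_div_one_div]
    rcases (h.t_ne n).lt_or_gt with ht | ht
    · obtain ⟨e0, e1⟩ := h.neg_t_eq ht
      have h1 := h.neg_half_le n
      rw [hn, hl] at e1
      rw [hl] at h1
      have hd1 : d n ≠ 1 := by
        intro hd
        rw [hd] at e1
        push_cast at e1
        rw [show 1 * 1 + -(1 - R) = R by ring, hRi] at e1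
        linarith
      have hd2 : d n ≠ 2 := by
        intro hd
        rw [hd] at e1
        push_cast at e1
        rw [show 2 * 1 + -(1 - R) = 1 + R by ring, hRi'] at e1
        linarith
      rw [(h.neg n ht).2, hl, ← hinv]
      by_cases hd3 : d n = 3
      · rw [hd3] at e1 ⊢
        push_cast at e1 ⊢
        rw [show 3 * 1 + -(1 - R) = 2 + R by ring, hinv] at e1
        have := ih (by linarith)
        exact one_div_le_one_div_of_le (by linarith) (by linarith)
      · have hd4 : 4 ≤ d n := by have := h.one_le_d n; omega
        have : (4 : ℝ) ≤ d n := by exact_mod_cast hd4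
        exact one_div_le_one_div_of_le (by linarith) (by linarith)
    · obtain ⟨e0, e1⟩ := h.t_eq ht
      have h1 := h.t_lt n
      have h2 := h.t_lt_one n
      rw [hn, hl] at e1
      rw [hl] at h1
      have hd1 : d n ≠ 1 := by
        intro hd
        rw [hd] at e1
        push_cast at e1
        rw [show 1 * 1 + -(1 - R) = R by ring, hRi] at e1
        linarith
      have hd2 : d n ≠ 2 := by
        intro hd
        rw [hd] at e1
        push_cast at e1
        rw [show 2 * 1 + -(1 - R) = 1 + R by ring, hRi'] at e1
        linarith
      rw [(h.pos n ht).2, ← hinv]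
      have := h.d_mul_ge_three hd1 hd2
      exact one_div_le_one_div_of_le (by linarith) (by linarith)

theorem not_widthsBelow_three (h : RosenOrbit 3 α t v d) (hR : IsOddRoot 1 R) (N : ℕ) :
    ¬ WidthsBelow t v (R + 1 / R) N := by
  intro hb
  have hR0 := hR.pos
  have hRr := hR.root
  have hR2 : 1 / 2 < R := by nlinarith
  have hR1 : R < 1 := hR.lt_one (by norm_num)
  have hl := lam_three
  have hinv : 1 / (1 - R) = 2 + R := by
    rw [div_eq_iff (by linarith)]; nlinarith
  have h0 := eq_zero_of_expanding (P := fun m => N < m) (D := fun m => t m + (1 - R))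
    (c := 2) (K := 3) (by norm_num)
    (fun m hm => by
      have h1 := h.neg_half_le m
      have := h.t_lt_one m
      rw [hl] at h1
      rw [abs_le]
      constructor <;> linarith)
    (fun m hm => by
      refine ⟨m + 1, by omega, ?_⟩
      have ht := h.three_neg hR hb hm
      have h1 := h.neg_half_le m
      rw [hl] at h1
      have e : t (m + 1) + (1 - R) = 1 / ((-t m) * (1 - R)) * (t m + (1 - R)) := by
        rw [h.three_step hR hb hm]
        have : 1 - R = 3 - 1 / (1 - R) := by rw [hinv]; ring
        nth_rewrite 1 [this]
        field_simp [show 1 - R ≠ 0 by linarith, ht.ne]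
        ring
      rw [e, abs_mul]
      refine mul_le_mul_of_nonneg_right (le_trans ?_ (le_abs_self _)) (abs_nonneg _)
      rw [le_div_iff₀ (mul_pos (by linarith) (by linarith))]
      nlinarith) (N + 1) (by omega)
  have h1 : t (N + 1) = -(1 - R) := by linarith
  -- That the fixed point lies in the interval is what provides α ≤ R.
  have h2 := h.le_t (N + 1)
  rw [hl] at h2
  have h3 := h.three_staircase hR (by linarith) _ h1
  have h4 := h.inv_v_add_t_lt hb le_rfl
  have h5 := one_div_le_one_div_of_le (h.unitBounded_three N).2.2 h3
  rw [hinv] at h5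
  rw [hR.inv_eq] at h4
  linarith

end RosenOrbit

end AlphaRosen

namespace AlphaRosen

noncomputable section

/-! ### Columns of the Hecke group -/

lemma coe_mul_apply (A B : Matrix.SpecialLinearGroup (Fin 2) ℝ) (i j : Fin 2) :
    (A * B).1 i j = A.1 i 0 * B.1 0 j + A.1 i 1 * B.1 1 j := by
  rw [show (A * B).1 = A.1 * B.1 from rfl, Matrix.mul_apply, Fin.sum_univ_two]

lemma coe_inv_eq (A : Matrix.SpecialLinearGroup (Fin 2) ℝ) :
    A⁻¹.1 = !![A.1 1 1, -A.1 0 1; -A.1 1 0, A.1 0 0] := by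
  rw [show A⁻¹.1 = A.1.adjugate from rfl, Matrix.adjugate_fin_two]

/-- The translation generator. -/
def genT (q : ℕ) : Matrix.SpecialLinearGroup (Fin 2) ℝ :=
  ⟨!![1, lam q; 0, 1], by simp [Matrix.det_fin_two]⟩

/-- The inversion generator. -/
def genS : Matrix.SpecialLinearGroup (Fin 2) ℝ := ⟨!![0, -1; 1, 0], by simp [Matrix.det_fin_two]⟩

lemma genT_mem (q : ℕ) : genT q ∈ heckeGroup q := Subgroup.subset_closure (Set.mem_insert _ _)

lemma genS_mem (q : ℕ) : genS ∈ heckeGroup q :=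
  Subgroup.subset_closure (Set.mem_insert_of_mem _ rfl)

lemma genT_val (q : ℕ) : (genT q).1 = !![1, lam q; 0, 1] := rfl

lemma genS_val : genS.1 = !![0, -1; 1, 0] := rfl

/-- `(a, c)` is the first column of an element of the Hecke group. -/
def IsHeckeColumn (q : ℕ) (a c : ℝ) : Prop := ∃ g ∈ heckeGroup q, g.1 0 0 = a ∧ g.1 1 0 = c

lemma isHeckeColumn_one_zero (q : ℕ) : IsHeckeColumn q 1 0 :=
  ⟨1, Subgroup.one_mem _, by simp, by simp⟩

namespace IsHeckeColumn

variable {q : ℕ} {a c : ℝ}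

lemma add (h : IsHeckeColumn q a c) : IsHeckeColumn q (a + lam q * c) c := by
  obtain ⟨g, hg, h1, h2⟩ := h
  refine ⟨_, Subgroup.mul_mem _ (genT_mem q) hg, ?_, ?_⟩
  · simp [coe_mul_apply, genT_val, h1, h2]
  · simp [coe_mul_apply, genT_val, h2]

lemma sub (h : IsHeckeColumn q a c) : IsHeckeColumn q (a - lam q * c) c := by
  obtain ⟨g, hg, h1, h2⟩ := h
  refine ⟨_, Subgroup.mul_mem _ (Subgroup.inv_mem _ (genT_mem q)) hg, ?_, ?_⟩
  · simp [coe_mul_apply, genT_val, h1, h2, sub_eq_add_neg]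
  · simp [coe_mul_apply, genT_val, h2]

lemma rot (h : IsHeckeColumn q a c) : IsHeckeColumn q (-c) a := by
  obtain ⟨g, hg, h1, h2⟩ := h
  refine ⟨_, Subgroup.mul_mem _ (genS_mem q) hg, ?_, ?_⟩
  · simp [coe_mul_apply, genS_val, h2]
  · simp [coe_mul_apply, genS_val, h1]

lemma neg (h : IsHeckeColumn q a c) : IsHeckeColumn q (-a) (-c) := h.rot.rot

/-- Induction on columns: a property of the column `(1, 0)` that is stable under the generators
and their inverses holds for all columns. -/
lemma induction {P : ℝ → ℝ → Prop} (one : P 1 0) (hadd : ∀ a c, P a c → P (a + lam q * c) c)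
    (hsub : ∀ a c, P a c → P (a - lam q * c) c) (hrot : ∀ a c, P a c → P (-c) a)
    (hrot' : ∀ a c, P a c → P c (-a)) (h : IsHeckeColumn q a c) : P a c := by
  obtain ⟨g, hg, rfl, rfl⟩ := h
  induction hg using Subgroup.closure_induction_left with
  | one => simpa using one
  | mul_left x hx y hy ih =>
    obtain rfl | rfl : x = genT q ∨ x = genS := hx
    · simpa [coe_mul_apply, genT_val, genS_val] using hadd _ _ ih
    · simpa [coe_mul_apply, genT_val, genS_val] using hrot _ _ ih
  | inv_mul_cancel x hx y hy ih =>
    obtain rfl | rfl : x = genT q ∨ x = genS := hx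
    · simpa [coe_mul_apply, genT_val, genS_val, coe_inv_eq, sub_eq_add_neg] using hsub _ _ ih
    · simpa [coe_mul_apply, genT_val, genS_val, coe_inv_eq] using hrot' _ _ ih

/-- Conjugation by diag(1, -1) inverts both generators, so it preserves the group. -/
lemma reflect (h : IsHeckeColumn q a c) : IsHeckeColumn q a (-c) := by
  refine h.induction (P := fun a c => IsHeckeColumn q a (-c)) ?_ ?_ ?_ ?_ ?_
  · simpa using isHeckeColumn_one_zero q
  · intro a c h; simpa using h.sub
  · intro a c h
    have := h.add
    rwa [mul_neg, ← sub_eq_add_neg] at this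
  · intro a c h; exact h.rot.neg |> fun h => by simpa using h
  · intro a c h; simpa using h.rot

lemma swap (h : IsHeckeColumn q a c) : IsHeckeColumn q c a := by
  simpa using h.reflect.rot

lemma add_int (h : IsHeckeColumn q a c) (m : ℤ) : IsHeckeColumn q (a + m * lam q * c) c := by
  induction m with
  | zero => simpa using h
  | succ m ih =>
    have := ih.add
    push_cast at this ⊢
    convert this using 1
    ring
  | pred m ih =>
    have := ih.sub
    push_cast at this ⊢
    convert this using 1
    ring

lemma ne_zero (h : IsHeckeColumn q a c) : a ≠ 0 ∨ c ≠ 0 := by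
  by_contra! hc
  obtain ⟨g, hg, h1, h2⟩ := h
  have := g.2
  rw [Matrix.det_fin_two] at this
  rw [h1, h2, hc.1, hc.2] at this
  simp at this

end IsHeckeColumn

lemma isHeckeRational_iff {q : ℕ} {x : ℝ} :
    IsHeckeRational q x ↔ ∃ a c, IsHeckeColumn q a c ∧ c ≠ 0 ∧ x = a / c := by
  constructor
  · rintro ⟨g, hg, h1, h2⟩
    exact ⟨_, _, ⟨g, hg, rfl, rfl⟩, h1, h2⟩
  · rintro ⟨a, c, ⟨g, hg, rfl, rfl⟩, h1, h2⟩
    exact ⟨g, hg, h1, h2⟩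

/-! ### Convergents -/

/-- The numerators `p_{n-1}`, starting with `p_{-1} = 1`. -/
def prevNum (q : ℕ) (α x : ℝ) : ℕ → ℝ
  | 0 => 1
  | n + 1 => convNum q α x n

/-- The denominators `q_{n-1}`, starting with `q_{-1} = 0`. -/
def prevDen (q : ℕ) (α x : ℝ) : ℕ → ℝ
  | 0 => 0
  | n + 1 => convDen q α x n

section

variable {q : ℕ} {α x : ℝ}

lemma convNum_succ (n : ℕ) : convNum q α x (n + 1) =
    dig q α x n * lam q * convNum q α x n + eps q α x n * prevNum q α x n := by
  cases n <;> simp [convNum, prevNum]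

lemma convDen_succ (n : ℕ) : convDen q α x (n + 1) =
    dig q α x n * lam q * convDen q α x n + eps q α x n * prevDen q α x n := by
  cases n <;> simp [convDen, prevDen]

lemma tail_succ {n : ℕ} (hn : tail q α x n ≠ 0) :
    tail q α x (n + 1) = eps q α x n / tail q α x n - lam q * dig q α x n := by
  rw [tail, Function.iterate_succ_apply', ← tail, rosenMap, if_neg hn]
  rfl

lemma eps_eq {n : ℕ} (hn : tail q α x n ≠ 0) : eps q α x n = 1 ∨ eps q α x n = -1 := by
  rcases hn.lt_or_gt with h | h
  · exact Or.inr (Real.sign_of_neg h)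
  · exact Or.inl (Real.sign_of_pos h)

/-- A factor with ε = 1 has determinant -1 and is not in the group, but it still maps columns to
columns because these are stable under `swap`. -/
lemma isHeckeColumn_conv {n : ℕ} (hn : ∀ k < n, tail q α x k ≠ 0) {a c : ℝ}
    (h : IsHeckeColumn q a c) :
    IsHeckeColumn q (prevNum q α x n * a + convNum q α x n * c)
      (prevDen q α x n * a + convDen q α x n * c) := by
  induction n generalizing a c with
  | zero => simpa [prevNum, prevDen, convNum, convDen] using h.add_int (digitZero q α x)
  | succ n ih =>
    have h1 : IsHeckeColumn q (eps q α x n * c) (a + dig q α x n * lam q * c) := by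
      have h2 := (h.add_int (dig q α x n)).swap
      rcases eps_eq (hn n (Nat.lt_succ_self n)) with e | e
      · rwa [e, one_mul]
      · rw [e, neg_one_mul]
        simpa using h2.neg.reflect
    have h3 := ih (fun k hk => hn k (by omega)) h1
    rw [convNum_succ, convDen_succ, prevNum, prevDen]
    convert h3 using 1 <;> ring

lemma isHeckeColumn_convNum_convDen {n : ℕ} (hn : ∀ k < n, tail q α x k ≠ 0) :
    IsHeckeColumn q (convNum q α x n) (convDen q α x n) := by
  simpa using isHeckeColumn_conv hn (a := 0) (c := 1) (by simpa using (isHeckeColumn_one_zero q).swap)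

lemma conv_error {n : ℕ} (hn : ∀ k < n, tail q α x k ≠ 0) :
    x * convDen q α x n - convNum q α x n =
      -tail q α x n * (x * prevDen q α x n - prevNum q α x n) := by
  induction n with
  | zero => simp [convDen, convNum, prevDen, prevNum, tail]
  | succ n ih =>
    have ih := ih (fun k hk => hn k (by omega))
    have h0 := hn n (Nat.lt_succ_self n)
    rw [tail_succ h0, convNum_succ, convDen_succ, prevNum, prevDen]
    have h1 : eps q α x n / tail q α x n * (x * convDen q α x n - convNum q α x n) =
        -eps q α x n * (x * prevDen q α x n - prevNum q α x n) := by
      rw [ih]; field_simp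
    linear_combination h1

/-- The tails of a `G_q`-irrational number never vanish. -/
lemma tail_ne_zero (hx : IsHeckeIrrational q x) (n : ℕ) : tail q α x n ≠ 0 := by
  induction n using Nat.strong_induction_on with
  | _ n ih =>
    intro h0
    have h1 := conv_error ih
    have h2 := isHeckeColumn_convNum_convDen ih
    rw [h0, neg_zero, zero_mul, sub_eq_zero] at h1
    have h3 : convDen q α x n ≠ 0 := by
      intro h3
      rw [h3, mul_zero] at h1
      rcases h2.ne_zero with h | h
      · exact h h1.symm
      · exact h h3
    exact hx (isHeckeRational_iff.mpr ⟨_, _, h2, h3, by rw [← h1]; field_simp⟩)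

lemma abs_det (hx : IsHeckeIrrational q x) (n : ℕ) :
    |prevNum q α x n * convDen q α x n - convNum q α x n * prevDen q α x n| = 1 := by
  induction n with
  | zero => simp [convDen, convNum, prevDen, prevNum]
  | succ n ih =>
    rw [convNum_succ, convDen_succ, prevNum, prevDen, ← ih]
    rw [show ∀ a b p p' r r' e : ℝ, p * (a * b * r + e * r') - (a * b * p + e * p') * r =
      -e * (p' * r - p * r') by intros; ring, abs_mul]
    rcases eps_eq (tail_ne_zero hx n (α := α)) with e | e <;> rw [e] <;> simp

lemma theta_eq (n : ℕ) :
    theta q α x n = |convDen q α x n| * |x * convDen q α x n - convNum q α x n| := by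
  rw [theta]
  rcases eq_or_ne (convDen q α x n) 0 with h | h
  · simp [h]
  · rw [← sq_abs, sq, mul_assoc, ← abs_mul, mul_sub, mul_div_cancel₀ _ h, mul_comm _ x]

/-! ### From convergents to orbits. -/

/-- The quotients `q_{n-1} / q_n`, defined by their recursion. -/
def denRatio (q : ℕ) (α x : ℝ) : ℕ → ℝ
  | 0 => 0
  | n + 1 => 1 / (dig q α x n * lam q + eps q α x n * denRatio q α x n)

lemma tail_mem (hq : 3 ≤ q) (n : ℕ) :
    (α - 1) * lam q ≤ tail q α x n ∧ tail q α x n < α * lam q ∨ tail q α x n = 0 := by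
  have hl := one_le_lam hq
  rcases n with _ | n
  · left
    have h1 := Int.floor_le (x / lam q + 1 - α)
    have h2 := Int.lt_floor_add_one (x / lam q + 1 - α)
    have h3 : x / lam q * lam q = x := div_mul_cancel₀ _ (by linarith)
    simp only [tail, Function.iterate_zero, id, digitZero]
    constructor <;> nlinarith
  · rw [tail, Function.iterate_succ_apply', ← tail, rosenMap]
    split_ifs with h
    · right; rfl
    · left
      have h1 := Int.floor_le (|1 / (lam q * tail q α x n)| + 1 - α)
      have h2 := Int.lt_floor_add_one (|1 / (lam q * tail q α x n)| + 1 - α)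
      have h3 : Real.sign (tail q α x n) / tail q α x n =
          |1 / (lam q * tail q α x n)| * lam q := by
        rw [abs_div, abs_mul, abs_one, abs_of_pos (show 0 < lam q by linarith)]
        rcases lt_or_gt_of_ne h with h' | h'
        · rw [Real.sign_of_neg h', abs_of_neg h']; field_simp
        · rw [Real.sign_of_pos h', abs_of_pos h']; field_simp
      rw [h3, digit]
      constructor <;> nlinarith

lemma rosenOrbit (hq : 3 ≤ q) (hα : α ∈ Set.Icc (1 / 2 : ℝ) (1 / lam q))
    (hx : IsHeckeIrrational q x) :
    RosenOrbit q α (tail q α x) (denRatio q α x) (dig q α x) := by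
  have hl := one_le_lam hq
  have hl2 := lam_lt_two hq
  have hne := tail_ne_zero hx (α := α)
  have hm := fun n => (tail_mem hq n (α := α) (x := x)).resolve_right (hne n)
  have hαl : α * lam q ≤ 1 := by rw [← le_div_iff₀ (by linarith)]; exact hα.2
  have hα1 := hα.1
  refine
    { three_le := hq
      half_le := hα.1
      mul_le_one := hαl
      le_t := fun n => (hm n).1
      t_lt := fun n => (hm n).2
      t_ne := hne
      one_le_d := fun n => ?_
      v_zero := rfl
      pos := fun n hn => ?_
      neg := fun n hn => ?_ }
  · rw [dig, digit, Int.le_floor]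
    push_cast
    have hpos : 0 < |lam q * tail q α x n| := by
      rw [abs_pos]; exact mul_ne_zero (by linarith) (hne n)
    suffices α ≤ |1 / (lam q * tail q α x n)| by linarith
    rw [abs_div, abs_one, le_div_iff₀ hpos, abs_mul, abs_of_pos (show 0 < lam q by linarith)]
    have : |tail q α x n| ≤ 1 := by
      rw [abs_le]
      constructor
      · nlinarith [(hm n).1]
      · linarith [(hm n).2]
    rw [← mul_assoc]
    exact mul_le_one₀ hαl (abs_nonneg _) this
  · have e : eps q α x n = 1 := Real.sign_of_pos hn
    refine ⟨by rw [tail_succ (hne n), e, mul_comm (lam q)], by rw [denRatio, e, one_mul]⟩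
  · have e : eps q α x n = -1 := Real.sign_of_neg hn
    refine ⟨by rw [tail_succ (hne n), e, mul_comm (lam q), neg_div, div_neg],
      by rw [denRatio, e, neg_one_mul, sub_eq_add_neg]⟩

lemma convDen_pos {α x : ℝ} (hv : UnitBounded (denRatio q α x)) (n : ℕ) :
    0 < convDen q α x n ∧ prevDen q α x n = denRatio q α x n * convDen q α x n := by
  induction n with
  | zero => simp [convDen, prevDen, denRatio]
  | succ n ih =>
    have h1 := (hv n).2.2
    have h2 : denRatio q α x (n + 1) =
      1 / (dig q α x n * lam q + eps q α x n * denRatio q α x n) := rfl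
    rw [h2] at h1
    have h3 := one_div_pos.mp h1
    have h4 : convDen q α x (n + 1) =
        (dig q α x n * lam q + eps q α x n * denRatio q α x n) * convDen q α x n := by
      rw [convDen_succ, ih.2]; ring
    refine ⟨by rw [h4]; exact mul_pos h3 ih.1, ?_⟩
    rw [h4, h2, prevDen, ← mul_assoc, one_div_mul_cancel h3.ne', one_mul]

/-- Combine `conv_error` with the determinant ±1 of consecutive convergents, written through v =
q_{n-1} / q_n. -/
lemma theta_mul (hx : IsHeckeIrrational q x) (hv : UnitBounded (denRatio q α x)) (n : ℕ)
    (h1 : 0 < 1 + tail q α x n * denRatio q α x n) :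
    theta q α x n * (1 + tail q α x n * denRatio q α x n) = |tail q α x n| := by
  obtain ⟨hq0, hq1⟩ := convDen_pos hv n
  have h2 := conv_error (fun k _ => tail_ne_zero hx k (α := α)) (n := n)
  have h3 := abs_det hx n (α := α)
  have h4 : prevNum q α x n * convDen q α x n - convNum q α x n * prevDen q α x n =
      -(x * prevDen q α x n - prevNum q α x n) *
        (convDen q α x n * (1 + tail q α x n * denRatio q α x n)) := by
    linear_combination
      prevDen q α x n * h2 - (x * prevDen q α x n - prevNum q α x n) * tail q α x n * hq1
  rw [h4, abs_mul, abs_neg, abs_mul, abs_of_pos h1] at h3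
  rw [theta_eq, h2, abs_mul, abs_neg]
  linear_combination |tail q α x n| * h3

lemma widthsBelow_of_theta (hq : 3 ≤ q) (hα : α ∈ Set.Icc (1 / 2 : ℝ) (1 / lam q))
    (hx : IsHeckeIrrational q x) (hv : UnitBounded (denRatio q α x)) {κ : ℝ} (hκ : 0 < κ) {N : ℕ}
    (h : ∀ n, N ≤ n → 1 / κ < theta q α x n) :
    WidthsBelow (tail q α x) (denRatio q α x) κ N := by
  intro n hn
  have ho := rosenOrbit hq hα hx
  have h0 := hv n
  have hl2 := lam_lt_two hq
  have h1 : 0 < 1 + tail q α x n * denRatio q α x n := by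
    have h5 : -1 < tail q α x n := by linarith [ho.neg_half_le n]
    rcases h0.1.eq_or_lt with h6 | h6
    · rw [← h6]; norm_num
    · nlinarith [h0.2.1]
  have h2 := theta_mul hx hv n h1
  have h3 := h n hn
  have h4 : 1 + tail q α x n * denRatio q α x n < κ * |tail q α x n| := by
    rw [← h2]
    rw [div_lt_iff₀ hκ] at h3
    nlinarith
  constructor
  · intro ht
    rw [abs_of_pos ht] at h4
    rw [← lt_sub_iff_add_lt, div_lt_iff₀ ht]
    linarith
  · intro ht
    rw [abs_of_neg ht] at h4
    rw [sub_lt_iff_lt_add, div_lt_iff₀ (by linarith)]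
    linarith

end

/-! ### The Hurwitz bound for all indices. -/

/-- The root `R` of `X² + (2 - λ) X - 1` for an odd index. -/
def oddRoot (l : ℝ) : ℝ := (l - 2 + Real.sqrt (l ^ 2 - 4 * l + 8)) / 2

lemma sq_sqrt_disc (l : ℝ) : Real.sqrt (l ^ 2 - 4 * l + 8) ^ 2 = l ^ 2 - 4 * l + 8 :=
  Real.sq_sqrt (by nlinarith [sq_nonneg (l - 2)])

lemma isOddRoot_oddRoot (l : ℝ) : IsOddRoot l (oddRoot l) := by
  have h := sq_sqrt_disc l
  constructor
  · have : 2 - l < Real.sqrt (l ^ 2 - 4 * l + 8) := by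
      apply Real.lt_sqrt_of_sq_lt; nlinarith
    rw [oddRoot]; linarith
  · rw [oddRoot]; nlinarith

lemma oddRoot_add_inv (l : ℝ) :
    oddRoot l + 1 / oddRoot l = Real.sqrt (l ^ 2 - 4 * l + 8) := by
  rw [(isOddRoot_oddRoot l).inv_eq, oddRoot]; ring

lemma index_cases {q : ℕ} (hq : 3 ≤ q) :
    q = 3 ∨ (∃ r, q = 2 * (r + 2)) ∨ ∃ r, q = 2 * r + 5 := by
  rcases Nat.even_or_odd' q with ⟨k, h | h⟩
  · exact Or.inr (Or.inl ⟨k - 2, by omega⟩)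
  · rcases Nat.lt_or_ge k 2 with hk | hk
    · left; omega
    · exact Or.inr (Or.inr ⟨k - 2, by omega⟩)

theorem infinite_theta_le {q : ℕ} (hq : 3 ≤ q) {α : ℝ}
    (hα : α ∈ Set.Icc (1 / 2 : ℝ) (1 / lam q)) {x : ℝ} (hx : IsHeckeIrrational q x) :
    {n : ℕ | theta q α x n ≤ hurwitzConst q}.Infinite := by
  intro hfin
  obtain ⟨N, hN⟩ := hfin.bddAbove
  have hN' : ∀ n, N + 1 ≤ n → hurwitzConst q < theta q α x n := by
    intro n hn
    by_contra! hc
    have := hN hc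
    omega
  have ho := rosenOrbit hq hα hx
  rcases index_cases hq with rfl | ⟨r, rfl⟩ | ⟨r, rfl⟩
  · have hR := isOddRoot_oddRoot 1
    refine ho.not_widthsBelow_three hR (N + 1)
      (widthsBelow_of_theta hq hα hx ho.unitBounded_three ?_ fun n hn => ?_)
    · have := hR.pos; positivity
    · have := hN' n hn
      rw [hurwitzConst, if_neg (by decide), lam_three] at this
      rwa [oddRoot_add_inv]
  · refine ho.not_widthsBelow_even (N + 1)
      (widthsBelow_of_theta hq hα hx (fun n => (ho.even_staircase n).1) two_pos fun n hn => ?_)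
    have := hN' n hn
    rwa [hurwitzConst, if_pos (by simp)] at this
  · have hR := isOddRoot_oddRoot (lam (2 * r + 5))
    refine ho.not_widthsBelow_odd hR (N + 1)
      (widthsBelow_of_theta hq hα hx ho.odd_unitBounded ?_ fun n hn => ?_)
    · have := hR.pos; positivity
    · have := hN' n hn
      rw [hurwitzConst, if_neg (by rw [Nat.not_even_iff_odd]; exact ⟨r + 2, by ring⟩)] at this
      rwa [oddRoot_add_inv]

end

end AlphaRosen

namespace AlphaRosen

/-! ### The minimum of the extremal forms on the columns of the Hecke group -/

/-- The nonnegative vectors obtained from the standard basis by the maps taking it to two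
consecutive vertices `(sn (k + 1), sn k)`, `(sn (k + 2), sn (k + 1))` of the fundamental polygon. -/
inductive IsTreeVector (q : ℕ) : ℝ → ℝ → Prop
  | left : IsTreeVector q 1 0
  | right : IsTreeVector q 0 1
  | step (k : ℕ) (hk : k + 1 < q) (u w : ℝ) (h : IsTreeVector q u w) :
      IsTreeVector q (sn q (k + 1) * u + sn q (k + 2) * w) (sn q k * u + sn q (k + 1) * w)

namespace IsTreeVector

variable {q : ℕ} {x y : ℝ}

lemma nonneg (hq : 3 ≤ q) (h : IsTreeVector q x y) : 0 ≤ x ∧ 0 ≤ y := by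
  induction h with
  | left => exact ⟨zero_le_one, le_rfl⟩
  | right => exact ⟨le_rfl, zero_le_one⟩
  | step k hk u w h ih =>
    obtain ⟨hu, hw⟩ := ih
    have h0 := sn_nonneg hq (show k ≤ q by omega)
    have h1 := sn_nonneg hq (show k + 1 ≤ q by omega)
    have h2 := sn_nonneg hq (show k + 2 ≤ q by omega)
    constructor <;> positivity

lemma one_le (hq : 3 ≤ q) (h : IsTreeVector q x y) : 1 ≤ x ∨ 1 ≤ y := by
  induction h with
  | left => exact Or.inl le_rfl
  | right => exact Or.inr le_rfl
  | step k hk u w h ih =>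
    obtain ⟨hu, hw⟩ := h.nonneg hq
    have h0 := sn_nonneg hq (show k ≤ q by omega)
    have h1 := one_le_sn hq (Nat.succ_pos k) hk
    have h2 := sn_nonneg hq (show k + 2 ≤ q by omega)
    have h3 := mul_nonneg h0 hu
    have h4 := mul_nonneg h2 hw
    rcases ih with h | h
    · left; nlinarith
    · right; nlinarith

/-- The reflection k ↦ q - 2 - k of the polygon exchanges the two coordinates. -/
lemma swap (hq : 3 ≤ q) (h : IsTreeVector q x y) : IsTreeVector q y x := by
  induction h with
  | left => exact right
  | right => exact left
  | step k hk u w h ih =>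
    have := step (q - 2 - k) (by omega) _ _ ih
    rw [sn_symm hq (show q - 2 - k + 1 + (k + 1) = q by omega),
      sn_symm hq (show q - 2 - k + 2 + k = q by omega),
      sn_symm hq (show q - 2 - k + (k + 2) = q by omega)] at this
    convert this using 1 <;> ring

lemma add_lam (hq : 3 ≤ q) (h : IsTreeVector q x y) : IsTreeVector q (x + lam q * y) y := by
  have := step 0 (by omega) _ _ h
  have h2 := sn_add_two q 0
  rw [zero_add, sn_zero, sn_one hq] at h2
  rw [zero_add, zero_add, sn_zero, sn_one hq, h2] at this
  convert this using 1 <;> ring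

/-- By the recursion, subtracting λ times the second coordinate turns step `k + 1` into step `k`, up
to sign and exchange of coordinates. -/
lemma sub_lam (hq : 3 ≤ q) (h : IsTreeVector q x y) : IsTreeVector q |x - lam q * y| y := by
  have hl := one_le_lam hq
  cases h with
  | left => simpa using left
  | right =>
    rw [mul_one, zero_sub, abs_neg, abs_of_pos (by linarith)]
    simpa using add_lam hq (right (q := q))
  | step k hk u w h =>
    obtain ⟨hu, hw⟩ := h.nonneg hq
    rcases k with _ | k
    · have h2 := sn_add_two q 0
      rw [zero_add, sn_zero, sn_one hq] at h2
      rw [zero_add, zero_add, sn_zero, sn_one hq, h2]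
      rw [show 1 * u + (lam q * 1 - 0) * w - lam q * (0 * u + 1 * w) = u by ring, abs_of_nonneg hu]
      simpa using h
    · have h1 := (step k (by omega) _ _ h).swap hq
      have e1 := sn_add_two q k
      have e2 := sn_add_two q (k + 1)
      have : sn q (k + 1 + 1) * u + sn q (k + 1 + 2) * w -
          lam q * (sn q (k + 1) * u + sn q (k + 1 + 1) * w) =
          -(sn q k * u + sn q (k + 1) * w) := by
        rw [show k + 1 + 1 = k + 2 by ring] at e2 ⊢
        rw [e2]
        linear_combination u * e1
      rw [this, abs_neg, abs_of_nonneg (nonneg hq (step k (by omega) _ _ h)).2]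
      exact h1

end IsTreeVector

lemma IsHeckeColumn.isTreeVector {q : ℕ} {a c : ℝ} (hq : 3 ≤ q) (h : IsHeckeColumn q a c) :
    IsTreeVector q |a| |c| := by
  have key : ∀ a c : ℝ, IsTreeVector q |a| |c| → IsTreeVector q |a + lam q * c| |c| := by
    intro a c h
    have hl := one_le_lam hq
    rcases le_total 0 a with ha | ha <;> rcases le_total 0 c with hc | hc
    · have := h.add_lam hq
      rw [abs_of_nonneg ha, abs_of_nonneg hc] at *
      rwa [abs_of_nonneg (by positivity)]
    · have := h.sub_lam hq
      rw [abs_of_nonneg ha, abs_of_nonpos hc] at *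
      convert this using 2; ring
    · have := h.sub_lam hq
      rw [abs_of_nonpos ha, abs_of_nonneg hc] at *
      rw [abs_sub_comm] at this
      convert this using 2; ring
    · have := h.add_lam hq
      rw [abs_of_nonpos ha, abs_of_nonpos hc] at *
      rw [abs_of_nonpos (by nlinarith)]
      convert this using 1; ring
  refine h.induction (P := fun a c => IsTreeVector q |a| |c|) ?_ key ?_ ?_ ?_
  · simpa using IsTreeVector.left
  · intro a c h
    have := key a (-c) (by rwa [abs_neg])
    rwa [abs_neg, mul_neg, ← sub_eq_add_neg] at this
  · intro a c h; rw [abs_neg]; exact h.swap hq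
  · intro a c h; rw [abs_neg]; exact h.swap hq

/-! ### Lower bounds for the forms on tree vectors. -/

lemma sn_le_succ {q k : ℕ} (hq : 3 ≤ q) (hk : 2 * k + 1 ≤ q) : sn q k ≤ sn q (k + 1) := by
  have hk' : 2 * (k : ℝ) + 1 ≤ q := by exact_mod_cast hk
  have h3 : (0 : ℝ) < q := by exact_mod_cast (by omega : 0 < q)
  have hθ := angle_pos hq
  have hqθ : q * (Real.pi / q) = Real.pi := by field_simp
  have hk0 : (0 : ℝ) ≤ k := k.cast_nonneg
  have h3' : (3 : ℝ) ≤ q := by exact_mod_cast hq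
  rw [sn, sn]
  refine div_le_div_of_nonneg_right ?_ (sin_angle_pos hq).le
  rw [← sub_nonneg, Real.sin_sub_sin]
  push_cast
  refine mul_nonneg (mul_nonneg zero_le_two ?_) ?_
  · apply Real.sin_nonneg_of_nonneg_of_le_pi <;> nlinarith
  · apply Real.cos_nonneg_of_neg_pi_div_two_le_of_le <;> nlinarith

/-- A form which is at least `1` on two nonnegative vectors is at least `1` on the combinations of
them whose coefficients are nonnegative and not both less than `1`. -/
lemma one_le_form_comb {β ρ σ x y x' y' u w : ℝ} (hρσ : ρ * σ = 1) (hβ : ρ - σ = β) (hσ : 0 < σ)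
    (hx : 0 < x) (hy : 0 ≤ y) (hx' : 0 < x') (hy' : 0 ≤ y') (hu : 0 ≤ u) (hw : 0 ≤ w)
    (huw : 1 ≤ u ∨ 1 ≤ w) (h : 1 ≤ x ^ 2 - β * x * y - y ^ 2)
    (h' : 1 ≤ x' ^ 2 - β * x' * y' - y' ^ 2) :
    1 ≤ (x * u + x' * w) ^ 2 - β * (x * u + x' * w) * (y * u + y' * w) -
      (y * u + y' * w) ^ 2 := by
  have fac : ∀ a b : ℝ, a ^ 2 - β * a * b - b ^ 2 = (a - ρ * b) * (a + σ * b) := by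
    intro a b; rw [← hβ]; linear_combination b ^ 2 * hρσ
  rw [fac] at h h' ⊢
  have p2 : 0 < x + σ * y := by positivity
  have p2' : 0 < x' + σ * y' := by positivity
  have p1 : 0 < x - ρ * y := (pos_iff_pos_of_mul_pos (by linarith)).mpr p2
  have p1' : 0 < x' - ρ * y' := (pos_iff_pos_of_mul_pos (by linarith)).mpr p2'
  -- Both linear factors are positive at both vectors, so all terms of this expansion are
  -- nonnegative.
  have e : (x * u + x' * w - ρ * (y * u + y' * w)) * (x * u + x' * w + σ * (y * u + y' * w)) =
      u ^ 2 * ((x - ρ * y) * (x + σ * y)) + w ^ 2 * ((x' - ρ * y') * (x' + σ * y')) +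
      u * w * ((x - ρ * y) * (x' + σ * y') + (x' - ρ * y') * (x + σ * y)) := by ring
  rw [e]
  have h1 : 0 ≤ u * w * ((x - ρ * y) * (x' + σ * y') + (x' - ρ * y') * (x + σ * y)) := by
    positivity
  have h2 : u ^ 2 ≤ u ^ 2 * ((x - ρ * y) * (x + σ * y)) := le_mul_of_one_le_right (sq_nonneg u) h
  have h3 : w ^ 2 ≤ w ^ 2 * ((x' - ρ * y') * (x' + σ * y')) :=
    le_mul_of_one_le_right (sq_nonneg w) h'
  rcases huw with h4 | h4 <;> nlinarith

lemma one_le_abs_even_form {p : ℕ} (hp : 2 ≤ p) {x y : ℝ} (h : IsTreeVector (2 * p) x y) :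
    1 ≤ |x ^ 2 - y ^ 2| := by
  have hq : 3 ≤ 2 * p := by omega
  have vert : ∀ k, k + 1 ≤ p → 1 ≤ sn (2 * p) (k + 1) ^ 2 - 0 * sn (2 * p) (k + 1) * sn (2 * p) k
      - sn (2 * p) k ^ 2 := by
    intro k hk
    have h1 := sn_det hq k
    have h2 : sn (2 * p) k ≤ sn (2 * p) (k + 2) := by
      rcases hk.eq_or_lt with h | h
      · rw [sn_symm hq (show k + 2 + k = 2 * p by omega)]
      · exact (sn_le_succ hq (by omega)).trans (sn_le_succ hq (by omega))
    have h3 := sn_nonneg hq (show k ≤ 2 * p by omega)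
    nlinarith
  have cone : ∀ k, k + 2 ≤ p → ∀ u w : ℝ, IsTreeVector (2 * p) u w →
      1 ≤ (sn (2 * p) (k + 1) * u + sn (2 * p) (k + 2) * w) ^ 2 -
        (sn (2 * p) k * u + sn (2 * p) (k + 1) * w) ^ 2 := by
    intro k hk u w h
    have := one_le_form_comb (β := 0) (ρ := 1) (σ := 1) (by norm_num) (by norm_num) one_pos
      (sn_pos hq (Nat.succ_pos k) (by omega)) (sn_nonneg hq (by omega))
      (sn_pos hq (Nat.succ_pos (k + 1)) (by omega)) (sn_nonneg hq (by omega))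
      (h.nonneg hq).1 (h.nonneg hq).2 (h.one_le hq) (vert k (by omega)) (vert (k + 1) hk)
    simpa using this
  induction h with
  | left => norm_num
  | right => norm_num
  | step k hk u w h ih =>
    rcases lt_trichotomy (k + 1) p with h1 | h1 | h1
    · exact (cone k h1 u w h).trans (le_abs_self _)
    -- For the middle side `sn k = sn (k + 2)`, and the map preserves the form; this is where the
    -- induction hypothesis enters.
    · have e1 := sn_det hq k
      have e2 := sn_symm hq (show k + 2 + k = 2 * p by omega)
      rw [e2] at e1 ⊢
      convert ih using 2
      linear_combination (u ^ 2 - w ^ 2) * e1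
    · have := cone (2 * p - 2 - k) (by omega) w u (h.swap hq)
      rw [sn_symm hq (show 2 * p - 2 - k + 1 + (k + 1) = 2 * p by omega),
        sn_symm hq (show 2 * p - 2 - k + 2 + k = 2 * p by omega),
        sn_symm hq (show 2 * p - 2 - k + (k + 2) = 2 * p by omega)] at this
      rw [abs_sub_comm]
      refine le_trans this (le_trans (le_of_eq ?_) (le_abs_self _))
      ring

/-- The forms for β and -β are treated together: the exchange of coordinates turns one into minus
the other, and the map of the middle side carries one to the other. -/
lemma one_le_abs_odd_form {p : ℕ} (hp : 1 ≤ p) {x y : ℝ} (h : IsTreeVector (2 * p + 1) x y) :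
    1 ≤ |x ^ 2 - (2 - lam (2 * p + 1)) * x * y - y ^ 2| ∧
      1 ≤ |x ^ 2 - (lam (2 * p + 1) - 2) * x * y - y ^ 2| := by
  have hq : 3 ≤ 2 * p + 1 := by omega
  set q := 2 * p + 1 with hqdef
  have hR := isOddRoot_oddRoot (lam q)
  set R := oddRoot (lam q)
  have hR0 := hR.pos
  have hRi := hR.inv_eq
  have hRp : 0 < 1 / R := one_div_pos.mpr hR0
  have hRm : R * (1 / R) = 1 := by rw [mul_one_div, div_self hR0.ne']
  have top : ∀ k, k + 1 ≤ p → 1 ≤ sn q (k + 1) ^ 2 - (2 - lam q) * sn q (k + 1) * sn q k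
      - sn q k ^ 2 := by
    intro k hk
    have h1 := sn_det hq k
    have h2 := sn_le_succ (k := k + 1) hq (by omega)
    have h3 := sn_nonneg hq (show k ≤ q by omega)
    have h4 := sn_add_two q k
    rw [show k + 1 + 1 = k + 2 by ring] at h2
    nlinarith [mul_nonneg h3 (sub_nonneg.mpr h2)]
  have bot : ∀ k, k ≤ p → 1 ≤ sn q (k + 1) ^ 2 - (lam q - 2) * sn q (k + 1) * sn q k
      - sn q k ^ 2 := by
    intro k hk
    have h1 := sn_det hq k
    have h2 := sn_le_succ (k := k) hq (by omega)
    have h3 := sn_nonneg hq (show k ≤ q by omega)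
    have h4 := sn_add_two q k
    nlinarith [mul_nonneg h3 (sub_nonneg.mpr h2)]
  have cone : ∀ k, k + 1 ≤ p → ∀ u w : ℝ, IsTreeVector q u w →
      1 ≤ |u ^ 2 - (lam q - 2) * u * w - w ^ 2| →
      1 ≤ |(sn q (k + 1) * u + sn q (k + 2) * w) ^ 2 - (2 - lam q) *
          (sn q (k + 1) * u + sn q (k + 2) * w) * (sn q k * u + sn q (k + 1) * w) -
          (sn q k * u + sn q (k + 1) * w) ^ 2| ∧
      1 ≤ |(sn q (k + 1) * u + sn q (k + 2) * w) ^ 2 - (lam q - 2) *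
          (sn q (k + 1) * u + sn q (k + 2) * w) * (sn q k * u + sn q (k + 1) * w) -
          (sn q k * u + sn q (k + 1) * w) ^ 2| := by
    intro k hk u w h ih
    constructor
    · rcases hk.eq_or_lt with h1 | h1
      · have e1 := sn_det hq k
        have e2 := sn_symm hq (show k + 2 + (k + 1) = q by omega)
        have e3 := sn_add_two q k
        have e4 : sn q k = (lam q - 1) * sn q (k + 1) := by linarith
        rw [e2, e4] at e1
        rw [e2, e4]
        convert ih using 2
        linear_combination (u ^ 2 - (lam q - 2) * u * w - w ^ 2) * e1
      · have := one_le_form_comb (β := 2 - lam q) (ρ := 1 / R) (σ := R) (by linarith)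
          (by linarith) hR0 (sn_pos hq (Nat.succ_pos k) (by omega)) (sn_nonneg hq (by omega))
          (sn_pos hq (Nat.succ_pos (k + 1)) (by omega)) (sn_nonneg hq (by omega))
          (h.nonneg hq).1 (h.nonneg hq).2 (h.one_le hq) (top k (by omega)) (top (k + 1) h1)
        exact this.trans (le_abs_self _)
    · have := one_le_form_comb (β := lam q - 2) (ρ := R) (σ := 1 / R) hRm (by linarith)
        hRp (sn_pos hq (Nat.succ_pos k) (by omega)) (sn_nonneg hq (by omega))
        (sn_pos hq (Nat.succ_pos (k + 1)) (by omega)) (sn_nonneg hq (by omega))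
        (h.nonneg hq).1 (h.nonneg hq).2 (h.one_le hq) (bot k (by omega)) (bot (k + 1) hk)
      exact this.trans (le_abs_self _)
  induction h with
  | left => norm_num
  | right => norm_num
  | step k hk u w h ih =>
    rcases Nat.lt_or_ge k p with h1 | h1
    · exact cone k h1 u w h ih.2
    · have := cone (q - 2 - k) (by omega) w u (h.swap hq) (by
        rw [← abs_neg]; convert ih.1 using 2; ring)
      rw [sn_symm hq (show q - 2 - k + 1 + (k + 1) = q by omega),
        sn_symm hq (show q - 2 - k + 2 + k = q by omega),
        sn_symm hq (show q - 2 - k + (k + 2) = q by omega)] at this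
      constructor
      · rw [← abs_neg]; convert this.2 using 2; ring
      · rw [← abs_neg]; convert this.1 using 2; ring

end AlphaRosen

namespace AlphaRosen

noncomputable section

/-! ### Optimality of the constant -/

/-- A form of discriminant `1 / H²` which is at least `1` on all columns. -/
lemma exists_extremal_form {q : ℕ} (hq : 3 ≤ q) : ∃ β κ : ℝ, 0 < κ ∧ κ ^ 2 = β ^ 2 + 4 ∧
    hurwitzConst q = 1 / κ ∧ ∀ a c, IsHeckeColumn q a c → 1 ≤ |a ^ 2 - β * a * c - c ^ 2| := by
  rcases Nat.even_or_odd' q with ⟨p, rfl | rfl⟩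
  · refine ⟨0, 2, two_pos, by norm_num, by rw [hurwitzConst, if_pos (by simp)], fun a c h => ?_⟩
    have := one_le_abs_even_form (by omega) (h.isTreeVector hq)
    rw [sq_abs, sq_abs] at this
    simpa using this
  · refine ⟨2 - lam (2 * p + 1), Real.sqrt (lam (2 * p + 1) ^ 2 - 4 * lam (2 * p + 1) + 8),
      Real.sqrt_pos.mpr (by nlinarith [sq_nonneg (lam (2 * p + 1) - 2)]), ?_,
      by rw [hurwitzConst, if_neg (by simp)], fun a c h => ?_⟩
    · rw [sq_sqrt_disc]; ring
    · obtain ⟨h1, h2⟩ := one_le_abs_odd_form (by omega) (h.isTreeVector hq)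
      rw [sq_abs, sq_abs, mul_assoc, ← abs_mul] at h1 h2
      rw [mul_assoc]
      rcases abs_cases (a * c) with ⟨e, -⟩ | ⟨e, -⟩ <;> rw [e] at h1 h2
      · exact h1
      · convert h2 using 2; ring

/-- A single tail may be close to 1 when αλ is, but after t n > λ / 2 the product is 1 - dλ t n,
which is small. Pairs of tails thus contract uniformly. -/
lemma abs_tail_mul_le {q : ℕ} {α x : ℝ} (hq : 3 ≤ q)
    (hα : α ∈ Set.Icc (1 / 2 : ℝ) (1 / lam q)) (hx : IsHeckeIrrational q x) (n : ℕ) :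
    |tail q α x n * tail q α x (n + 1)| ≤ lam q / 2 := by
  have h := rosenOrbit hq hα hx
  have hl := one_le_lam hq
  have hl2 := lam_lt_two hq
  have h1 := h.neg_half_le
  have h2 := h.t_lt_one
  by_cases hn : tail q α x n ≤ lam q / 2
  · have h3 : |tail q α x n| ≤ lam q / 2 := abs_le.mpr ⟨h1 n, hn⟩
    have h4 : |tail q α x (n + 1)| ≤ 1 :=
      abs_le.mpr ⟨by linarith [h1 (n + 1)], (h2 (n + 1)).le⟩
    rw [abs_mul]
    nlinarith [abs_nonneg (tail q α x n), abs_nonneg (tail q α x (n + 1))]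
  · rw [not_le] at hn
    have ht : 0 < tail q α x n := by linarith
    have e := (h.pos n ht).1
    have e1 : tail q α x n * tail q α x (n + 1) = 1 - dig q α x n * lam q * tail q α x n := by
      rw [e]; field_simp
    have h3 := h.d_mul_ge n
    have h4 := h1 (n + 1)
    have h5 := h2 n
    rw [abs_le]
    constructor
    · nlinarith
    · rw [e1]; nlinarith

lemma abs_conv_error_le {q : ℕ} {α x : ℝ} (hq : 3 ≤ q)
    (hα : α ∈ Set.Icc (1 / 2 : ℝ) (1 / lam q)) (hx : IsHeckeIrrational q x) (n : ℕ) :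
    |x * convDen q α x n - convNum q α x n| ≤ (lam q / 2) ^ (n / 2) := by
  have hl := one_le_lam hq
  have hne := tail_ne_zero hx (α := α)
  have h := rosenOrbit hq hα hx
  have ht : ∀ k, |tail q α x k| ≤ 1 := fun k =>
    abs_le.mpr ⟨by linarith [h.neg_half_le k, lam_lt_two hq], (h.t_lt_one k).le⟩
  have hrec := fun n => conv_error (fun k (_ : k < n) => hne k)
  induction n using Nat.twoStepInduction with
  | zero => rw [hrec]; simpa [prevDen, prevNum] using ht 0
  | one =>
    rw [hrec, prevDen, prevNum, hrec]
    simpa [prevDen, prevNum, abs_mul] using mul_le_one₀ (ht 1) (abs_nonneg _) (ht 0)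
  | more n ih _ =>
    rw [hrec, prevDen, prevNum, hrec, prevDen, prevNum, Nat.add_div_right n two_pos, pow_succ']
    have e : ∀ a b c : ℝ, -b * (-a * c) = a * b * c := by intros; ring
    rw [e, abs_mul]
    exact mul_le_mul (abs_tail_mul_le hq hα hx (n + 1)) ih (abs_nonneg _) (by linarith)

theorem exists_finite_theta_le {q : ℕ} (hq : 3 ≤ q) {α : ℝ}
    (hα : α ∈ Set.Icc (1 / 2 : ℝ) (1 / lam q)) {c : ℝ} (hc : c < hurwitzConst q) :
    ∃ x ∈ Set.Ico ((α - 1) * lam q) (α * lam q), IsHeckeIrrational q x ∧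
      {n : ℕ | theta q α x n ≤ c}.Finite := by
  obtain ⟨β, κ, hκ, hβ, hH, hform⟩ := exists_extremal_form hq
  have hl := one_le_lam hq
  have hl2 := lam_lt_two hq
  set m := ⌊(β + κ) / 2 / lam q + 1 - α⌋ with hm
  set x := (β + κ) / 2 - m * lam q with hxdef
  -- The form factors over its roots, which differ by κ; replacing a by a + mλb keeps columns and
  -- moves the chosen root to x.
  have key : ∀ a b, IsHeckeColumn q a b → 1 ≤ |(a - x * b) * (a - x * b + κ * b)| := by
    intro a b h
    convert hform _ _ (h.add_int m) using 2
    rw [hxdef]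
    linear_combination (-(b ^ 2) / 4) * hβ
  have hx : IsHeckeIrrational q x := by
    intro hx
    obtain ⟨a, b, h, hb, e⟩ := isHeckeRational_iff.mp hx
    have := key a b h
    rw [e, div_mul_cancel₀ _ hb, sub_self, zero_mul, abs_zero] at this
    linarith
  refine ⟨x, ?_, hx, ?_⟩
  · have h1 := Int.floor_le ((β + κ) / 2 / lam q + 1 - α)
    have h2 := Int.lt_floor_add_one ((β + κ) / 2 / lam q + 1 - α)
    have h3 : (β + κ) / 2 / lam q * lam q = (β + κ) / 2 := div_mul_cancel₀ _ (by linarith)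
    rw [← hm] at h1 h2
    constructor <;> nlinarith
  · have hgap : 0 < 1 - κ * c := by
      rw [hH, lt_div_iff₀ hκ] at hc
      linarith
    obtain ⟨M, hM⟩ := exists_pow_lt_of_lt_one hgap (show lam q / 2 < 1 by linarith)
    refine (Set.finite_lt_nat (2 * M)).subset fun n hn => ?_
    simp only [Set.mem_ofPred_eq] at hn ⊢
    have h1 := key _ _ (isHeckeColumn_convNum_convDen
      (fun k (_ : k < n) => tail_ne_zero hx k (α := α)))
    have h2 := abs_conv_error_le hq hα hx n
    have h3 := theta_eq (q := q) (α := α) (x := x) n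
    set E := x * convDen q α x n - convNum q α x n
    set Q := convDen q α x n
    rw [show convNum q α x n - x * Q = -E by simp only [E, Q]; ring, abs_mul, abs_neg] at h1
    have h4 : |-E + κ * Q| ≤ |E| + κ * |Q| := by
      refine (abs_add_le _ _).trans ?_
      rw [abs_neg, abs_mul, abs_of_pos hκ]
    have h5 : |E| * |-E + κ * Q| ≤ |E| * (|E| + κ * |Q|) :=
      mul_le_mul_of_nonneg_left h4 (abs_nonneg _)
    -- If Θ_n ≤ c, this forces |E|² ≥ 1 - κc > (λ / 2)^M, and the decay of E leaves only n < 2M.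
    have h6 : 1 ≤ |E| ^ 2 + κ * theta q α x n := by rw [h3]; linarith
    have h7 : (lam q / 2) ^ (n / 2) ≤ 1 := pow_le_one₀ (by linarith) (by linarith)
    have h8 : |E| ^ 2 ≤ (lam q / 2) ^ (n / 2) := by nlinarith [abs_nonneg E]
    have h9 : (lam q / 2) ^ M < (lam q / 2) ^ (n / 2) := by nlinarith
    have := (pow_lt_pow_iff_right_of_lt_one₀ (by linarith) (by linarith)).mp h9
    omega

end

end AlphaRosen

theorem mainTheorem1 (q : ℕ) (hq : 3 ≤ q) (α : ℝ)
    (hα : α ∈ Set.Icc (1 / 2 : ℝ) (1 / AlphaRosen.lam q)) :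
    (∀ x : ℝ, AlphaRosen.IsHeckeIrrational q x →
      {n : ℕ | AlphaRosen.theta q α x n ≤ AlphaRosen.hurwitzConst q}.Infinite) ∧
    (∀ c : ℝ, c < AlphaRosen.hurwitzConst q →
      ∃ x ∈ Set.Ico ((α - 1) * AlphaRosen.lam q) (α * AlphaRosen.lam q),
        AlphaRosen.IsHeckeIrrational q x ∧
        {n : ℕ | AlphaRosen.theta q α x n ≤ c}.Finite) :=
  ⟨fun _ hx => AlphaRosen.infinite_theta_le hq hα hx,
    fun _ hc => AlphaRosen.exists_finite_theta_le hq hα hc⟩
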